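/- **Setting.** There is a finite set $I$ of resources; resource $i$ has $c_i\ge 1$ units, and $c_{\min}=\min_i c_i$. Arrivals $t=1,\dots,T$ occur at times $a(1)<\dots<a(T)$; arrival $t$ has a set $S_t\subseteq I$ of neighbors and a choice model: if it is offered the assortment $A$, it chooses item $i\in A$ with probability $\phi_t(A,i)$ and nothing with probability $1-\sum_{i\in A}\phi_t(A,i)$. Feasible assortments form a downward closed family $\mathcal F\ni\emptyset$, and choice is substitutable: $\phi_t(B,i)\le\phi_t(A,i)$ whenever $i\in A\subseteq B$. A unit of $i$ chosen by arrival $t$ is in use for a random duration $d\in[0,\infty]$ drawn independently from the distribution $F_i$; it is available again from time $a(t)+d$ on, and the use earns $r_i(d)$, where $r_i(\cdot)\ge 0$ is non-decreasing with finite mean $r_i=E_{d\sim F_i}[r_i(d)]$. $\mathrm{OPT}$ is the supremum of the expected total reward over clairvoyant policies. Such a policy knows the whole instance (all arrivals, times, neighborhoods, choice models and distributions) in advance, offers each arrival $t$ a feasible subset of those resources in $S_t$ of which a unit is in stock, and bases the offer on the realized earlier choices and on the realized durations of the units that have returned by time $a(t)$ (and on knowing which units have not returned), but on nothing else that is random.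 **Guide algorithm.** Put $g(x)=e^{-x}$. The algorithm is deterministic and keeps for each unit $k\in\{1,\dots,c_i\}$ of $i$ an available fraction $z_i(k)$, initially $1$. On arrival $t$ it first adds to $z_i(k)$ the fluid returns $$\sum_{\tau<t}\big(R_i(\tau,t)-R_i(\tau,t-1)\big)\,y_i(k,\tau),\qquad R_i(\tau,s)=F_i\big(a(s)-a(\tau)\big)\text{ if }\tau<s,\quad R_i(\tau,\tau)=0,$$ where $y_i(k,\tau)$ is the fraction of unit $k$ consumed by arrival $\tau$. Then it sets $\eta=0$ and $y_i(k,t)=0$ and repeats the following as long as $\eta<1$. Let $k^*(i)$ be the largest $k\le c_i$ with $z_i(k)>0$ ($0$ if there is none); stop if no $i\in S_t$ has $k^*(i)>0$. Otherwise let $A$ be an assortment that maximizes $$\sum_{i\in A} r_i\Big(1-g\big(k^*(i)/c_i\big)\Big)\phi_t(A,i)$$ over the feasible subsets of $\{i\in S_t: k^*(i)>0\}$, and that contains no item with $\phi_t(A,i)=0$, as returned by an arbitrary oracle. Let $y=\min\{1-\eta,\ \min_{i\in A} z_i(k^*(i))/\phi_t(A,i)\}$; increase $\eta$ by $y$, and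 for each $i\in A$ increase $y_i(k^*(i),t)$ and decrease $z_i(k^*(i))$ by $y\,\phi_t(A,i)$. Finally let $\mathrm{GALG}=\sum_t\sum_i\sum_{k=1}^{c_i} r_i\,y_i(k,t)$. **Lemma.** There is an absolute constant $C$ such that for every instance and every revenue-maximizing oracle, $$\mathrm{GALG}\ \ge\ \Big(1-\frac1e-\frac{C}{c_{\min}}\Big)\,\mathrm{OPT}.$$ -/

import Mathlib

open MeasureTheory
open scoped ENNReal

universe u

noncomputable section

namespace ReusableAssortment

/-- The outcome of a customer's choice (`some i`: item `i` is chosen, `none`: nothing is chosen)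
carries the discrete sigma-algebra. -/
instance outcomeMeasurableSpace (I : Type u) : MeasurableSpace (Option I) := ⊤

/-- An instance of online assortment allocation of reusable resources, with resource set `I`.
Arrivals are indexed by `Fin T` in their order of arrival. -/
structure Instance (I : Type u) [Fintype I] [DecidableEq I] where
  /-- number of arrivals -/
  T : ℕ
  /-- arrival times `a(t)`; at most one arrival at any moment -/
  arrivalTime : Fin T → ℝ
  arrivalTime_strictMono : StrictMono arrivalTime
  /-- `S_t`, the resources that have an edge to arrival `t` -/
  neighbors : Fin T → Finset I
  /-- starting inventories `c_i` -/
  inventory : I → ℕ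
  inventory_pos : ∀ i, 0 < inventory i
  /-- usage distributions `F_i`; a duration `∞` means that the unit never returns -/
  usage : I → ProbabilityMeasure ℝ≥0∞
  /-- `reward i d` is the reward earned when a unit of `i` is used for a duration `d` -/
  reward : I → ℝ≥0∞ → ℝ
  reward_nonneg : ∀ i d, 0 ≤ reward i d
  reward_mono : ∀ i, Monotone (reward i)
  reward_integrable : ∀ i, Integrable (reward i) (usage i : Measure ℝ≥0∞)
  /-- feasible assortments -/
  feasible : Set (Finset I)
  empty_feasible : ∅ ∈ feasible
  feasible_downward : ∀ A ∈ feasible, ∀ B, B ⊆ A → B ∈ feasible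
  /-- `choice t A` is the law of the choice of arrival `t` when it is offered `A` -/
  choice : Fin T → Finset I → PMF (Option I)
  choice_mem : ∀ t A i, i ∉ A → choice t A (some i) = 0
  /-- substitutability: a larger assortment makes each of its old items less likely -/
  choice_antitone : ∀ t A B i, A ⊆ B → i ∈ A → choice t B (some i) ≤ choice t A (some i)

variable {I : Type u} [Fintype I] [DecidableEq I]

namespace Instance

/-- Choice probability `φ_t(A, i)`. -/
def phi (P : Instance I) (t : Fin P.T) (A : Finset I) (i : I) : ℝ :=
  (P.choice t A (some i)).toReal

/-- Distribution function `F_i(x)`: probability that a use of `i` lasts at most `x`. -/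
def cdf (P : Instance I) (i : I) (x : ℝ) : ℝ :=
  ((P.usage i : Measure ℝ≥0∞) (Set.Iic (ENNReal.ofReal x))).toReal

/-- Expected reward `r_i` of one use of `i`. -/
def meanReward (P : Instance I) (i : I) : ℝ :=
  ∫ d, P.reward i d ∂(P.usage i : Measure ℝ≥0∞)

/-- The smallest starting inventory. -/
def cMin (P : Instance I) : ℕ := ⨅ i, P.inventory i

/-! ### The clairvoyant optimum -/

/-- A sample path: `ω.1 t i` is the usage duration if `i` is allocated to arrival `t`, and
`ω.2 t A` is the choice that arrival `t` makes if it is offered `A`. -/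
abbrev Path (P : Instance I) : Type u :=
  (Fin P.T → I → ℝ≥0∞) × (Fin P.T → Finset I → Option I)

/-- The law of the sample path: all durations and choices are independent, durations of `i` have
law `F_i`, and the choice of `t` from `A` has law `choice t A`. -/
def pathLaw (P : Instance I) : Measure P.Path :=
  (Measure.pi fun _ : Fin P.T => Measure.pi fun i : I => (P.usage i : Measure ℝ≥0∞)).prod
    (Measure.pi fun t : Fin P.T => Measure.pi fun A : Finset I => (P.choice t A).toMeasure)

/-- What arrival `t` chooses on path `ω` under the offers `offer`. -/
def chosen (P : Instance I) (offer : Fin P.T → P.Path → Finset I) (t : Fin P.T) (ω : P.Path) :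
    Option I :=
  ω.2 t (offer t ω)

/-- A use of `i` that begins with arrival `τ` has ended by the time arrival `t` occurs. -/
def Returned (P : Instance I) (i : I) (τ t : Fin P.T) (ω : P.Path) : Prop :=
  ω.1 τ i ≤ ENNReal.ofReal (P.arrivalTime t - P.arrivalTime τ)

open Classical in
/-- Number of units of `i` that are in use when arrival `t` occurs. -/
def inUse (P : Instance I) (offer : Fin P.T → P.Path → Finset I) (i : I) (t : Fin P.T)
    (ω : P.Path) : ℕ :=
  (Finset.univ.filter fun τ : Fin P.T =>
    τ < t ∧ P.chosen offer τ ω = some i ∧ ¬ P.Returned i τ t ω).card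

/-- On the paths `ω` and `ω'` exactly the same is observed before arrival `t` is served: the same
items were chosen by the earlier arrivals, the same units have come back by now, and those that
have come back were used for the same durations. -/
def SameHistory (P : Instance I) (offer : Fin P.T → P.Path → Finset I) (t : Fin P.T)
    (ω ω' : P.Path) : Prop :=
  ∀ τ, τ < t → P.chosen offer τ ω = P.chosen offer τ ω' ∧
    ∀ i, P.chosen offer τ ω = some i →
      (P.Returned i τ t ω ↔ P.Returned i τ t ω') ∧
      (P.Returned i τ t ω → ω.1 τ i = ω'.1 τ i)

/-- A clairvoyant policy knows the whole instance in advance, but its offer to arrival `t` depends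
on the sample path only through what has been observed so far. Offers are feasible assortments of
neighbors that have a unit in stock. -/
structure Policy (P : Instance I) where
  offer : Fin P.T → P.Path → Finset I
  measurable_offer : ∀ t A, MeasurableSet {ω | offer t ω = A}
  offer_neighbors : ∀ t ω, offer t ω ⊆ P.neighbors t
  offer_feasible : ∀ t ω, offer t ω ∈ P.feasible
  offer_available : ∀ t ω, ∀ i ∈ offer t ω, P.inUse offer i t ω < P.inventory i
  nonanticipating : ∀ t ω ω', P.SameHistory offer t ω ω' → offer t ω = offer t ω'

/-- Total reward of a policy on a sample path. -/
def Policy.total {P : Instance I} (π : P.Policy) (ω : P.Path) : ℝ :=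
  ∑ t, (P.chosen π.offer t ω).elim 0 fun i => P.reward i (ω.1 t i)

/-- Expected total reward of a policy. -/
def Policy.value {P : Instance I} (π : P.Policy) : ℝ :=
  ∫ ω, π.total ω ∂P.pathLaw

/-- `OPT`: the optimal expected total reward of a clairvoyant policy. -/
def opt (P : Instance I) : ℝ := ⨆ π : P.Policy, π.value

instance pathLaw_isProbabilityMeasure (P : Instance I) : IsProbabilityMeasure P.pathLaw := by
  unfold pathLaw; infer_instance

instance policy_nonempty (P : Instance I) : Nonempty P.Policy :=
  ⟨{ offer := fun _ _ => ∅
     measurable_offer := fun _ _ => MeasurableSet.const _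
     offer_neighbors := fun _ _ => Finset.empty_subset _
     offer_feasible := fun _ _ => P.empty_feasible
     offer_available := fun _ _ i hi => absurd hi (Finset.notMem_empty i)
     nonanticipating := fun _ _ _ _ => rfl }⟩

/-- The supremum that defines `opt` is over a bounded set. -/
theorem bddAbove_value (P : Instance I) :
    BddAbove (Set.range fun π : P.Policy => π.value) := by
  refine ⟨∫ ω, ∑ t, ∑ i, P.reward i (ω.1 t i) ∂P.pathLaw, ?_⟩
  rintro _ ⟨π, rfl⟩
  have hint : Integrable (fun ω : P.Path => ∑ t, ∑ i, P.reward i (ω.1 t i)) P.pathLaw := by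
    refine integrable_finsetSum _ fun t _ => integrable_finsetSum _ fun i _ => ?_
    have h1 : MeasurePreserving (fun x : I → ℝ≥0∞ => x i)
        (Measure.pi fun i : I => (P.usage i : Measure ℝ≥0∞)) (P.usage i : Measure ℝ≥0∞) :=
      measurePreserving_eval _ i
    have h2 : MeasurePreserving (fun x : Fin P.T → I → ℝ≥0∞ => x t)
        (Measure.pi fun _ : Fin P.T => Measure.pi fun i : I => (P.usage i : Measure ℝ≥0∞))
        (Measure.pi fun i : I => (P.usage i : Measure ℝ≥0∞)) :=
      measurePreserving_eval
        (fun _ : Fin P.T => Measure.pi fun i : I => (P.usage i : Measure ℝ≥0∞)) t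
    exact ((h1.comp h2).integrable_comp_of_integrable (P.reward_integrable i)).comp_fst _
  refine integral_mono_of_nonneg (.of_forall fun ω => ?_) hint (.of_forall fun ω => ?_)
  · refine Finset.sum_nonneg fun t _ => ?_
    cases P.chosen π.offer t ω with
    | none => exact le_rfl
    | some i => exact P.reward_nonneg _ _
  · refine Finset.sum_le_sum fun t _ => ?_
    cases P.chosen π.offer t ω with
    | none => exact Finset.sum_nonneg fun i _ => P.reward_nonneg _ _
    | some i =>
      exact Finset.single_le_sum (f := fun i => P.reward i (ω.1 t i))
        (fun i _ => P.reward_nonneg _ _) (Finset.mem_univ i)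

/-! ### The guide algorithm -/

/-- `oracle t S p` is a revenue-maximizing feasible assortment for the choice model of arrival `t`,
among the subsets of `S`, for nonnegative prices `p`; it never includes an item that has zero
probability of being chosen. -/
def IsRevenueOracle (P : Instance I) (oracle : Fin P.T → Finset I → (I → ℝ) → Finset I) : Prop :=
  ∀ t S (p : I → ℝ), (∀ i, 0 ≤ p i) →
    oracle t S p ⊆ S ∧ oracle t S p ∈ P.feasible ∧
    (∀ i ∈ oracle t S p, 0 < P.phi t (oracle t S p) i) ∧
    ∀ B, B ⊆ S → B ∈ P.feasible →
      ∑ i ∈ B, p i * P.phi t B i ≤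
        ∑ i ∈ oracle t S p, p i * P.phi t (oracle t S p) i

/-- The state of the while loop that serves one arrival: `served` is the fraction `η` of the
arrival served so far, `avail i k` is the fraction `z_i(k)` of unit `k` of resource `i` that is
available, and `used i k` is the fraction `y_i(k, t)` of it consumed by the arrival so far.
The units of `i` are `k = 1, …, c_i`. -/
structure LoopState (I : Type u) where
  served : ℝ
  avail : I → ℕ → ℝ
  used : I → ℕ → ℝ

/-- `k*(i)`: the highest unit of `i` of which a positive fraction is available, `0` if none is. -/
def topUnit (P : Instance I) (z : I → ℕ → ℝ) (i : I) : ℕ :=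
  ((Finset.Icc 1 (P.inventory i)).filter fun k => 0 < z i k).sup id

/-- Reduced price `r_i (1 - g(k*(i) / c_i))` with `g(x) = exp(-x)`. -/
def reducedPrice (P : Instance I) (z : I → ℕ → ℝ) (i : I) : ℝ :=
  P.meanReward i * (1 - Real.exp (-((P.topUnit z i : ℝ) / (P.inventory i : ℝ))))

/-- The neighbors of `t` of which some unit is available to a positive fraction. -/
def inStock (P : Instance I) (t : Fin P.T) (z : I → ℕ → ℝ) : Finset I :=
  (P.neighbors t).filter fun i => 0 < P.topUnit z i

/-- The condition under which the while loop goes on. -/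
def Continues (P : Instance I) (t : Fin P.T) (s : LoopState I) : Prop :=
  s.served < 1 ∧ (P.inStock t s.avail).Nonempty

/-- The assortment that the loop offers next. -/
def offered (P : Instance I) (oracle : Fin P.T → Finset I → (I → ℝ) → Finset I) (t : Fin P.T)
    (s : LoopState I) : Finset I :=
  oracle t (P.inStock t s.avail) (P.reducedPrice s.avail)

/-- The fraction of the arrival to which it is offered:
the minimum of `1 - η` and of `z_i(k*(i)) / φ(A, i)` over `i ∈ A`. -/
def offeredFraction (P : Instance I) (oracle : Fin P.T → Finset I → (I → ℝ) → Finset I)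
    (t : Fin P.T) (s : LoopState I) : ℝ :=
  (P.offered oracle t s).fold min (1 - s.served) fun i =>
    s.avail i (P.topUnit s.avail i) / P.phi t (P.offered oracle t s) i

/-- The fraction of unit `k` of `i` that is consumed by this offer under fluid choice. -/
def consumed (P : Instance I) (oracle : Fin P.T → Finset I → (I → ℝ) → Finset I)
    (t : Fin P.T) (s : LoopState I) (i : I) (k : ℕ) : ℝ :=
  if i ∈ P.offered oracle t s ∧ k = P.topUnit s.avail i then
    P.offeredFraction oracle t s * P.phi t (P.offered oracle t s) i
  else 0

open Classical in
/-- One pass through the while loop; nothing happens once the loop has been left. -/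
def loopStep (P : Instance I) (oracle : Fin P.T → Finset I → (I → ℝ) → Finset I)
    (t : Fin P.T) (s : LoopState I) : LoopState I :=
  if P.Continues t s then
    { served := s.served + P.offeredFraction oracle t s
      avail := fun i k => s.avail i k - P.consumed oracle t s i k
      used := fun i k => s.used i k + P.consumed oracle t s i k }
  else s

/-- The while loop, started with availabilities `z`; it ends after at most `∑ i, c_i` passes,
see `not_continues_loop`. -/
def loop (P : Instance I) (oracle : Fin P.T → Finset I → (I → ℝ) → Finset I)
    (t : Fin P.T) (z : I → ℕ → ℝ) : LoopState I :=
  (P.loopStep oracle t)^[∑ i, P.inventory i] ⟨0, z, fun _ _ => 0⟩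

theorem meanReward_nonneg (P : Instance I) (i : I) : 0 ≤ P.meanReward i :=
  integral_nonneg fun d => P.reward_nonneg i d

theorem reducedPrice_nonneg (P : Instance I) (z : I → ℕ → ℝ) (i : I) : 0 ≤ P.reducedPrice z i := by
  refine mul_nonneg (P.meanReward_nonneg i) (sub_nonneg.2 (Real.exp_le_one_iff.2 ?_))
  exact neg_nonpos.2 (by positivity)

/-- Revenue oracles exist. -/
theorem exists_isRevenueOracle (P : Instance I) : ∃ oracle, P.IsRevenueOracle oracle := by
  classical
  suffices h : ∀ (t : Fin P.T) (S : Finset I) (p : I → ℝ), ∃ A : Finset I, (∀ i, 0 ≤ p i) →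
      A ⊆ S ∧ A ∈ P.feasible ∧ (∀ i ∈ A, 0 < P.phi t A i) ∧
      ∀ B, B ⊆ S → B ∈ P.feasible → ∑ i ∈ B, p i * P.phi t B i ≤ ∑ i ∈ A, p i * P.phi t A i by
    choose oracle ho using h
    exact ⟨oracle, ho⟩
  intro t S p
  by_cases hp : ∀ i, 0 ≤ p i
  swap
  · exact ⟨∅, fun h => absurd h hp⟩
  obtain ⟨A₀, hA₀, hmax₀⟩ := Finset.exists_max_image (S.powerset.filter (· ∈ P.feasible))
    (fun B => ∑ i ∈ B, p i * P.phi t B i) ⟨∅, by simp [P.empty_feasible]⟩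
  obtain ⟨A, hA, hmin⟩ := Finset.exists_min_image
    ((S.powerset.filter (· ∈ P.feasible)).filter fun B =>
      ∑ i ∈ A₀, p i * P.phi t A₀ i ≤ ∑ i ∈ B, p i * P.phi t B i)
    Finset.card ⟨A₀, by rw [Finset.mem_filter]; exact ⟨hA₀, le_rfl⟩⟩
  simp only [Finset.mem_filter, Finset.mem_powerset] at hA hmin hmax₀
  refine ⟨A, fun _ => ⟨hA.1.1, hA.1.2, fun i hi => ?_,
    fun B hB hBf => (hmax₀ B ⟨hB, hBf⟩).trans hA.2⟩⟩
  refine lt_of_le_of_ne ENNReal.toReal_nonneg fun h0 => ?_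
  have hlt := Finset.card_erase_lt_of_mem hi
  refine absurd (hmin (A.erase i) ⟨⟨(Finset.erase_subset _ _).trans hA.1.1,
    P.feasible_downward A hA.1.2 _ (Finset.erase_subset _ _)⟩, hA.2.trans ?_⟩) (not_le.2 hlt)
  rw [← Finset.add_sum_erase A _ hi, ← h0, mul_zero, zero_add]
  refine Finset.sum_le_sum fun j hj => mul_le_mul_of_nonneg_left ?_ (hp j)
  exact ENNReal.toReal_mono (PMF.apply_ne_top _ _)
    (P.choice_antitone t _ _ j (Finset.erase_subset _ _) hj)

theorem topUnit_mono (P : Instance I) {z z' : I → ℕ → ℝ} (h : ∀ i k, z' i k ≤ z i k) (i : I) :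
    P.topUnit z' i ≤ P.topUnit z i := by
  refine Finset.sup_mono fun k hk => ?_
  rw [Finset.mem_filter] at hk ⊢
  exact ⟨hk.1, hk.2.trans_le (h i k)⟩

theorem topUnit_mem (P : Instance I) (z : I → ℕ → ℝ) (i : I) (h : 0 < P.topUnit z i) :
    P.topUnit z i ∈ (Finset.Icc 1 (P.inventory i)).filter fun k => 0 < z i k := by
  have hne : ((Finset.Icc 1 (P.inventory i)).filter fun k => 0 < z i k).Nonempty := by
    rw [Finset.nonempty_iff_ne_empty]
    intro h0
    simp [topUnit, h0] at h
  obtain ⟨k, hk, hk'⟩ := Finset.exists_mem_eq_sup _ hne id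
  rw [topUnit, hk']
  exact hk

theorem loopStep_cases (P : Instance I) {oracle : Fin P.T → Finset I → (I → ℝ) → Finset I}
    (ho : P.IsRevenueOracle oracle) (t : Fin P.T) (s : LoopState I) (hs : P.Continues t s) :
    (P.loopStep oracle t s).served = 1 ∨
      ∑ i, P.topUnit (P.loopStep oracle t s).avail i < ∑ i, P.topUnit s.avail i := by
  obtain ⟨hsub, -, hpos, -⟩ :=
    ho t (P.inStock t s.avail) (P.reducedPrice s.avail) (P.reducedPrice_nonneg s.avail)
  change P.offered oracle t s ⊆ _ at hsub
  change ∀ i ∈ P.offered oracle t s, 0 < P.phi t (P.offered oracle t s) i at hpos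
  have hz : ∀ i ∈ P.offered oracle t s, 0 < s.avail i (P.topUnit s.avail i) := fun i hi =>
    (Finset.mem_filter.1 (P.topUnit_mem s.avail i (Finset.mem_filter.1 (hsub hi)).2)).2
  have hy0 : 0 ≤ P.offeredFraction oracle t s :=
    (Finset.le_fold_min _).2 ⟨by linarith [hs.1], fun i hi => (div_pos (hz i hi) (hpos i hi)).le⟩
  have hstep : P.loopStep oracle t s =
      { served := s.served + P.offeredFraction oracle t s
        avail := fun i k => s.avail i k - P.consumed oracle t s i k
        used := fun i k => s.used i k + P.consumed oracle t s i k } := if_pos hs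
  have hc0 : ∀ i k, 0 ≤ P.consumed oracle t s i k := by
    intro i k
    unfold consumed
    split_ifs
    · exact mul_nonneg hy0 ENNReal.toReal_nonneg
    · exact le_rfl
  have hmono : ∀ i, P.topUnit (P.loopStep oracle t s).avail i ≤ P.topUnit s.avail i := by
    intro i
    refine P.topUnit_mono (fun j k => ?_) i
    rw [hstep]
    exact sub_le_self _ (hc0 j k)
  rcases (Finset.fold_min_le (P.offeredFraction oracle t s)).1
    (le_refl (P.offeredFraction oracle t s)) with h | ⟨i, hi, h⟩
  · left
    have h' := ((Finset.le_fold_min _).1 (le_refl (P.offeredFraction oracle t s))).1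
    rw [hstep]
    change s.served + P.offeredFraction oracle t s = 1
    linarith
  · right
    have h' := ((Finset.le_fold_min _).1 (le_refl (P.offeredFraction oracle t s))).2 i hi
    have heq := le_antisymm h' h
    refine Finset.sum_lt_sum (fun j _ => hmono j) ⟨i, Finset.mem_univ i, ?_⟩
    refine lt_of_le_of_ne (hmono i) fun hEq => ?_
    have hpos' : 0 < P.topUnit (P.loopStep oracle t s).avail i := by
      rw [hEq]; exact (Finset.mem_filter.1 (hsub hi)).2
    have hm := (Finset.mem_filter.1 (P.topUnit_mem _ i hpos')).2
    rw [hEq, hstep] at hm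
    simp only [consumed, hi, true_and, if_true] at hm
    rw [heq, div_mul_cancel₀ _ (hpos i hi).ne', sub_self] at hm
    exact lt_irrefl _ hm

/-- After `∑ i, c_i` passes the while loop has ended. -/
theorem not_continues_loop (P : Instance I) {oracle : Fin P.T → Finset I → (I → ℝ) → Finset I}
    (ho : P.IsRevenueOracle oracle) (t : Fin P.T) (z : I → ℕ → ℝ) :
    ¬ P.Continues t (P.loop oracle t z) := by
  have hfix : ∀ s, ¬ P.Continues t s → ∀ n, (P.loopStep oracle t)^[n] s = s := fun s hs n =>
    Function.iterate_fixed (show P.loopStep oracle t s = s from if_neg hs) n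
  have key : ∀ (n : ℕ) (s : LoopState I), ∑ i, P.topUnit s.avail i ≤ n →
      ¬ P.Continues t ((P.loopStep oracle t)^[n] s) := by
    intro n
    induction n with
    | zero =>
      rintro s hs ⟨-, i, hi⟩
      have h0 := (Finset.sum_eq_zero_iff.1 (Nat.le_zero.1 hs)) i (Finset.mem_univ i)
      exact absurd (Finset.mem_filter.1 hi).2 (by simp [h0])
    | succ n ih =>
      intro s hs
      by_cases hC : P.Continues t s
      · rw [Function.iterate_succ_apply]
        rcases P.loopStep_cases ho t s hC with h | h
        · have hn : ¬ P.Continues t (P.loopStep oracle t s) := fun h' => by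
            have := h'.1
            linarith
          rw [hfix _ hn]
          exact hn
        · exact ih _ (by omega)
      · rw [hfix s hC]
        exact hC
  refine key _ _ (Finset.sum_le_sum fun i _ => ?_)
  exact Finset.sup_le fun k hk => (Finset.mem_Icc.1 (Finset.mem_filter.1 hk).1).2

/-- The part of the amounts of `i` consumed by `τ` that has been made available again at the times
up to and including arrival `t`. Nothing comes back before the arrival after `τ`. -/
def returnedFraction (P : Instance I) (i : I) (τ t : Fin P.T) : ℝ :=
  if τ < t then P.cdf i (P.arrivalTime t - P.arrivalTime τ) else 0

/-- The state between arrivals: `avail i k` is `z_i(k)`, and `matched i k τ` is `y_i(k, τ)`. -/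
structure GuideState (P : Instance I) where
  avail : I → ℕ → ℝ
  matched : I → ℕ → Fin P.T → ℝ

/-- Fluid return of used units between arrival `t - 1` and arrival `t`. -/
def refreshed (P : Instance I) (t : Fin P.T) (s : P.GuideState) (i : I) (k : ℕ) : ℝ :=
  s.avail i k + ∑ τ ∈ Finset.univ.filter (· < t),
    (P.returnedFraction i τ t -
      P.returnedFraction i τ ⟨t.val - 1, lt_of_le_of_lt (Nat.sub_le _ _) t.isLt⟩) *
    s.matched i k τ

/-- Serving arrival `t`: fluid return, then the while loop. -/
def serve (P : Instance I) (oracle : Fin P.T → Finset I → (I → ℝ) → Finset I)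
    (t : Fin P.T) (s : P.GuideState) : P.GuideState where
  avail := (P.loop oracle t (P.refreshed t s)).avail
  matched := fun i k => Function.update (s.matched i k) t
    ((P.loop oracle t (P.refreshed t s)).used i k)

/-- The state of the guide algorithm after the first `n` arrivals. -/
def guideState (P : Instance I) (oracle : Fin P.T → Finset I → (I → ℝ) → Finset I) :
    ℕ → P.GuideState
  | 0 => ⟨fun _ _ => 1, fun _ _ _ => 0⟩
  | n + 1 => if h : n < P.T then P.serve oracle ⟨n, h⟩ (P.guideState oracle n)
      else P.guideState oracle n

/-- `GALG`: the total reward of the guide algorithm, `∑_t ∑_i ∑_k r_i y_i(k, t)`. -/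
def galg (P : Instance I) (oracle : Fin P.T → Finset I → (I → ℝ) → Finset I) : ℝ :=
  ∑ t, ∑ i, ∑ k ∈ Finset.Icc 1 (P.inventory i),
    P.meanReward i * (P.guideState oracle P.T).matched i k t

end Instance

end ReusableAssortment

end

noncomputable section

namespace ReusableAssortment

/-! The proof is a primal-dual comparison of the guide algorithm with a fluid relaxation of the
clairvoyant optimum.

Relaxation. An offer to `t` is decided before the choice and the duration of `t` are revealed, hence
is independent of them. A policy therefore enters only through its offer probabilities `p t A` and
the choice probabilities `x t i = ∑ A, p t A * φ_t(A, i)`: its value is `∑ r_i x t i`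
(`Policy.value_eq`). At most `c_i` units are ever out, so `∑ τ ≤ t, K_i(t, τ) x τ i ≤ c_i`, where
`K_i(t, τ)` is the probability that a use begun at `τ` is still running at `t`
(`Policy.sum_inUseFraction_mul_le`).

Splitting the reward. Of the reward `r_i` earned by unit `k`, the share `r_i (1 - exp(-k/c_i))` is
credited to the arrival and `r_i exp(-k/c_i)` to the unit. Let `m` be the top available unit of `i`
after `t`. Prices only fall while `t` is served and every offer is optimal at its prices, so the
share of `t` is at least the revenue of any feasible assortment at the final prices
(`sum_reducedPrice_le_reducedValue_loop`); averaging over `p t` gives `∑ i, r_i (1 - exp(-m/c_i)) x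
t i`.

Share of the units. All units `k > m` are exhausted after `t`. Since `K_i(t, τ)` increases with `τ`,
a unit exhausted at certain arrivals has total fluid use at least `1/c_i` times the mass of `x` on
them (`sum_le_mul_sum_of_exhausted`), although units return and are used again. Weighting by
`exp(-k/c_i)` and comparing a Riemann sum with an integral, each bit of `x t i` is paid at least
`r_i (exp(-m/c_i) - 1/e - 1/c_i)`. In the sum of both shares `m` cancels and `1 - 1/e - 1/c_i`
remains. -/

/-! ### Analytic preliminaries -/

/-- Abel summation against a kernel that is increasing in its second argument: if the kernel
transforms of `d` are nonnegative on `U` and `d` is nonnegative off `U`, the sum of `d` is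
nonnegative. -/
theorem sum_nonneg_and_sum_mul_le {α : Type*} [LinearOrder α] (M : α → α → ℝ) (U : Set α)
    (d : α → ℝ) (hM0 : ∀ t τ, 0 ≤ M t τ) (hM1 : ∀ t, M t t = 1)
    (hM : ∀ t τ τ', τ ≤ τ' → τ' ≤ t → M t τ ≤ M t τ') (s : Finset α) :
    (∀ t ∈ s, t ∉ U → 0 ≤ d t) →
    (∀ t ∈ s, t ∈ U → 0 ≤ ∑ τ ∈ s.filter (· ≤ t), M t τ * d τ) →
    0 ≤ ∑ τ ∈ s, d τ ∧ ∀ (w : α → ℝ) (C : ℝ), (∀ τ ∈ s, 0 ≤ w τ) → MonotoneOn w s →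
      (∀ τ ∈ s, w τ ≤ C) → ∑ τ ∈ s, w τ * d τ ≤ C * ∑ τ ∈ s, d τ := by
  induction s using Finset.induction_on_max with
  | empty => simp
  | insert a s ha ih =>
    intro hd hU
    have hna : a ∉ s := fun h => lt_irrefl _ (ha a h)
    obtain ⟨h0, hw⟩ := ih (fun t ht => hd t (Finset.mem_insert_of_mem ht)) fun t ht htU => by
      have := hU t (Finset.mem_insert_of_mem ht) htU
      rwa [Finset.filter_insert, if_neg (not_le.2 (ha t ht))] at this
    have hD : 0 ≤ ∑ τ ∈ insert a s, d τ := by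
      rw [Finset.sum_insert hna]
      by_cases haU : a ∈ U
      · have h1 := hU a (Finset.mem_insert_self _ _) haU
        rw [Finset.filter_true_of_mem, Finset.sum_insert hna, hM1, one_mul] at h1
        -- Row `a` of the kernel is itself an admissible weight bounded by `1`. This is why the
        -- weighted inequality has to be carried through the induction.
        · have h2 := hw (M a) 1 (fun τ _ => hM0 a τ)
            (fun τ _ τ' hτ' h => hM a τ τ' h (ha τ' hτ').le)
            (fun τ hτ => (hM a τ a (ha τ hτ).le le_rfl).trans_eq (hM1 a))
          linarith
        · intro τ hτ
          rcases Finset.mem_insert.1 hτ with rfl | h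
          exacts [le_rfl, (ha τ h).le]
      · exact add_nonneg (hd a (Finset.mem_insert_self _ _) haU) h0
    refine ⟨hD, fun w C hw0 hwm hwC => ?_⟩
    -- By monotonicity the newest weight bounds all earlier ones, so it can play the role of `C`.
    have h1 := hw w (w a) (fun τ hτ => hw0 τ (Finset.mem_insert_of_mem hτ))
      (hwm.mono (by simp)) fun τ hτ =>
        hwm (by simp [hτ]) (by simp) (ha τ hτ).le
    calc ∑ τ ∈ insert a s, w τ * d τ
        = w a * d a + ∑ τ ∈ s, w τ * d τ := Finset.sum_insert hna
      _ ≤ w a * ∑ τ ∈ insert a s, d τ := by rw [Finset.sum_insert hna, mul_add]; linarith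
      _ ≤ C * ∑ τ ∈ insert a s, d τ :=
        mul_le_mul_of_nonneg_right (hwC a (Finset.mem_insert_self _ _)) hD

/-- A unit that is completely in use at all times of `U` has been used at least as often as any
usage restricted to `U` can achieve per unit of capacity. -/
theorem sum_le_mul_sum_of_exhausted {α : Type*} [LinearOrder α] [Fintype α] (M : α → α → ℝ)
    (U : Set α) [DecidablePred (· ∈ U)] (x y : α → ℝ) (c : ℝ) (hM0 : ∀ t τ, 0 ≤ M t τ)
    (hM1 : ∀ t, M t t = 1) (hM : ∀ t τ τ', τ ≤ τ' → τ' ≤ t → M t τ ≤ M t τ') (hc : 0 ≤ c)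
    (hx : ∀ t, 0 ≤ x t) (hy : ∀ t, 0 ≤ y t)
    (hxc : ∀ t, ∑ τ ∈ Finset.univ.filter (· ≤ t), M t τ * x τ ≤ c)
    (hyU : ∀ t ∈ U, 1 ≤ ∑ τ ∈ Finset.univ.filter (· ≤ t), M t τ * y τ) :
    ∑ t, (if t ∈ U then x t else 0) ≤ c * ∑ t, y t := by
  -- On `U` the transform of `c * y` is at least `c` and that of the restricted `x` at most `c`; off
  -- `U` only `c * y` is left.
  have h := (sum_nonneg_and_sum_mul_le M U (fun t => c * y t - if t ∈ U then x t else 0)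
    hM0 hM1 hM Finset.univ (fun t _ ht => by simpa [ht] using mul_nonneg hc (hy t))
    fun t _ ht => ?_).1
  · rw [Finset.sum_sub_distrib, ← Finset.mul_sum] at h
    linarith
  · simp only [mul_sub, Finset.sum_sub_distrib]
    have h1 : ∑ τ ∈ Finset.univ.filter (· ≤ t), M t τ * (if τ ∈ U then x τ else 0) ≤ c := by
      refine (Finset.sum_le_sum fun τ _ => mul_le_mul_of_nonneg_left ?_ (hM0 t τ)).trans (hxc t)
      split_ifs
      exacts [le_rfl, hx τ]
    have h2 : ∑ τ ∈ Finset.univ.filter (· ≤ t), M t τ * (c * y τ) =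
        c * ∑ τ ∈ Finset.univ.filter (· ≤ t), M t τ * y τ := by
      rw [Finset.mul_sum]
      exact Finset.sum_congr rfl fun τ _ => by ring
    have h3 := mul_le_mul_of_nonneg_left (hyU t ht) hc
    linarith

/-- Riemann sum bound for the exponential function. -/
theorem exp_sub_le_sum_exp {c : ℕ} (hc : 0 < c) {m : ℕ} (hm : m ≤ c) :
    Real.exp (-((m : ℝ) / c)) - 1 / Real.exp 1 - 1 / c ≤
      1 / c * ∑ k ∈ (Finset.Icc 1 c).filter (m < ·), Real.exp (-((k : ℝ) / c)) := by
  have hc' : (0 : ℝ) < c := Nat.cast_pos.2 hc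
  -- From `1 - 1/c ≤ exp(-1/c)`: left-endpoint sums dominate the telescoping differences.
  have hstep : ∀ k : ℕ, Real.exp (-((k : ℝ) / c)) - Real.exp (-((k + 1 : ℕ) / c : ℝ)) ≤
      1 / c * Real.exp (-((k : ℝ) / c)) := by
    intro k
    have h1 := Real.add_one_le_exp (-(1 / c : ℝ))
    have h2 : Real.exp (-((k + 1 : ℕ) / c : ℝ)) =
        Real.exp (-((k : ℝ) / c)) * Real.exp (-(1 / c : ℝ)) := by
      rw [← Real.exp_add]; push_cast; congr 1; ring
    rw [h2]
    nlinarith [Real.exp_pos (-((k : ℝ) / c))]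
  have htel : Real.exp (-((m : ℝ) / c)) - Real.exp (-((c : ℝ) / c)) ≤
      ∑ k ∈ Finset.Ico m c, 1 / c * Real.exp (-((k : ℝ) / c)) := by
    have := Finset.sum_Ico_sub (fun k : ℕ => -Real.exp (-((k : ℝ) / c))) hm
    calc _ = ∑ k ∈ Finset.Ico m c,
            (-Real.exp (-((k + 1 : ℕ) / c : ℝ)) - -Real.exp (-((k : ℝ) / c))) := by
          rw [this]; ring
      _ ≤ _ := Finset.sum_le_sum fun k _ => by linarith [hstep k]
  have hset : (Finset.Icc 1 c).filter (m < ·) = Finset.Ioc m c := by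
    ext k; simp only [Finset.mem_filter, Finset.mem_Icc, Finset.mem_Ioc]; omega
  -- Passing from left to right endpoints loses at most the term `k = m`, which is at most `1`. This
  -- is the only source of the loss `1 / c`.
  have hshift : ∑ k ∈ Finset.Ico m c, Real.exp (-((k : ℝ) / c)) ≤
      1 + ∑ k ∈ Finset.Ioc m c, Real.exp (-((k : ℝ) / c)) := by
    rcases hm.eq_or_lt with rfl | hlt
    · simp
    · have h1 : Finset.Ico m c = insert m (Finset.Ioo m c) := by
        ext k; simp only [Finset.mem_Ico, Finset.mem_insert, Finset.mem_Ioo]; omega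
      rw [h1, Finset.sum_insert (by simp)]
      refine add_le_add (Real.exp_le_one_iff.2 (by simp; positivity)) ?_
      exact Finset.sum_le_sum_of_subset_of_nonneg
        (fun k hk => by simp only [Finset.mem_Ioo, Finset.mem_Ioc] at *; omega)
        fun _ _ _ => (Real.exp_pos _).le
  rw [div_self hc'.ne', ← Finset.mul_sum] at htel
  have := mul_le_mul_of_nonneg_left hshift (one_div_pos.2 hc').le
  rw [hset, one_div (Real.exp 1), ← Real.exp_neg]
  linarith

/-! ### Resampling a coordinate of a product measure -/

/-- The preimage of a box is the box with side `i` freed, times side `i`. Resampling serves in place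
of factoring the product measure along coordinate `i`. -/
theorem measurePreserving_update {ι : Type*} [Fintype ι] [DecidableEq ι] {X : ι → Type*}
    [∀ i, MeasurableSpace (X i)] (μ : ∀ i, Measure (X i)) [∀ i, IsProbabilityMeasure (μ i)]
    (i : ι) :
    MeasurePreserving (fun p : (∀ j, X j) × X i => Function.update p.1 i p.2)
      ((Measure.pi μ).prod (μ i)) (Measure.pi μ) := by
  refine ⟨measurable_update', (Measure.pi_eq fun s hs => ?_).symm⟩
  rw [Measure.map_apply measurable_update' (MeasurableSet.univ_pi hs)]
  have : (fun p : (∀ j, X j) × X i => Function.update p.1 i p.2) ⁻¹' Set.univ.pi s =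
      (Set.univ.pi (Function.update s i Set.univ)) ×ˢ s i := by
    ext ⟨x, y⟩
    simp only [Set.mem_preimage, Set.mem_univ_pi, Set.mem_prod]
    constructor
    · intro h
      refine ⟨fun j => ?_, by simpa using h i⟩
      rcases eq_or_ne j i with rfl | hj
      · simp
      · simpa [hj] using h j
    · rintro ⟨h, hy⟩ j
      rcases eq_or_ne j i with rfl | hj
      · simpa using hy
      · simpa [hj] using h j
  rw [this, Measure.prod_prod, Measure.pi_pi, ← Finset.mul_prod_erase _ _ (Finset.mem_univ i),
    ← Finset.mul_prod_erase Finset.univ (fun j => μ j (s j)) (Finset.mem_univ i),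
    Function.update_self, measure_univ, one_mul, mul_comm]
  congr 1
  exact Finset.prod_congr rfl fun j hj => by rw [Function.update_of_ne (Finset.ne_of_mem_erase hj)]

/-- A function that ignores coordinate `i` is independent of coordinate `i`. -/
theorem lintegral_mul_eval {ι : Type*} [Fintype ι] [DecidableEq ι] {X : ι → Type*}
    [∀ i, MeasurableSpace (X i)] (μ : ∀ i, Measure (X i)) [∀ i, IsProbabilityMeasure (μ i)]
    (i : ι) {f : (∀ j, X j) → ℝ≥0∞} {g : X i → ℝ≥0∞} (hf : Measurable f) (hg : Measurable g)
    (hfi : ∀ x y, f (Function.update x i y) = f x) :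
    ∫⁻ x, f x * g (x i) ∂Measure.pi μ = (∫⁻ x, f x ∂Measure.pi μ) * ∫⁻ y, g y ∂μ i := by
  have hm : Measurable fun x : ∀ j, X j => f x * g (x i) :=
    hf.mul (hg.comp (measurable_pi_apply i))
  rw [← (measurePreserving_update μ i).lintegral_comp hm]
  simp only [hfi, Function.update_self]
  exact lintegral_prod_mul hf.aemeasurable hg.aemeasurable

namespace Instance

variable {I : Type u} [Fintype I] [DecidableEq I]

/-! ### The while loop -/

theorem phi_nonneg (P : Instance I) (t : Fin P.T) (A : Finset I) (i : I) : 0 ≤ P.phi t A i :=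
  ENNReal.toReal_nonneg

theorem phi_antitone (P : Instance I) (t : Fin P.T) {A B : Finset I} {i : I} (h : A ⊆ B)
    (hi : i ∈ A) : P.phi t B i ≤ P.phi t A i :=
  ENNReal.toReal_mono (PMF.apply_ne_top _ _) (P.choice_antitone t A B i h hi)

theorem topUnit_le (P : Instance I) (z : I → ℕ → ℝ) (i : I) : P.topUnit z i ≤ P.inventory i :=
  Finset.sup_le fun _ hk => (Finset.mem_Icc.1 (Finset.mem_filter.1 hk).1).2

theorem avail_nonpos_of_topUnit_lt (P : Instance I) (z : I → ℕ → ℝ) {i : I} {k : ℕ}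
    (hk : k ∈ Finset.Icc 1 (P.inventory i)) (h : P.topUnit z i < k) : z i k ≤ 0 := by
  by_contra hz
  have hle : k ≤ P.topUnit z i :=
    Finset.le_sup (f := id) (Finset.mem_filter.2 ⟨hk, not_le.1 hz⟩)
  omega

theorem reducedPrice_mono (P : Instance I) {z z' : I → ℕ → ℝ} (h : ∀ i k, z' i k ≤ z i k)
    (i : I) : P.reducedPrice z' i ≤ P.reducedPrice z i := by
  have hc : (0 : ℝ) < P.inventory i := Nat.cast_pos.2 (P.inventory_pos i)
  have ht : (P.topUnit z' i : ℝ) ≤ P.topUnit z i := Nat.cast_le.2 (P.topUnit_mono h i)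
  unfold reducedPrice
  gcongr
  exact P.meanReward_nonneg i

theorem reducedPrice_eq_zero (P : Instance I) {z : I → ℕ → ℝ} {i : I} (h : P.topUnit z i = 0) :
    P.reducedPrice z i = 0 := by
  simp [reducedPrice, h]

/-- The value of the consumption `y` at the reduced prices of the units. -/
def reducedValue (P : Instance I) (y : I → ℕ → ℝ) : ℝ :=
  ∑ i, ∑ k ∈ Finset.Icc 1 (P.inventory i),
    P.meanReward i * (1 - Real.exp (-((k : ℝ) / (P.inventory i : ℝ)))) * y i k

section Step

variable (P : Instance I) {oracle : Fin P.T → Finset I → (I → ℝ) → Finset I}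
  (ho : P.IsRevenueOracle oracle) (t : Fin P.T) (s : LoopState I)

include ho

theorem offered_spec :
    P.offered oracle t s ⊆ P.inStock t s.avail ∧
    (∀ i ∈ P.offered oracle t s, 0 < P.phi t (P.offered oracle t s) i) ∧
    ∀ B, B ⊆ P.inStock t s.avail → B ∈ P.feasible →
      ∑ i ∈ B, P.reducedPrice s.avail i * P.phi t B i ≤
        ∑ i ∈ P.offered oracle t s,
          P.reducedPrice s.avail i * P.phi t (P.offered oracle t s) i := by
  obtain ⟨h1, -, h2, h3⟩ :=
    ho t (P.inStock t s.avail) (P.reducedPrice s.avail) (P.reducedPrice_nonneg s.avail)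
  exact ⟨h1, h2, h3⟩

theorem topUnit_mem_of_offered {i : I} (hi : i ∈ P.offered oracle t s) :
    P.topUnit s.avail i ∈
      (Finset.Icc 1 (P.inventory i)).filter fun k => 0 < s.avail i k :=
  P.topUnit_mem s.avail i (Finset.mem_filter.1 ((P.offered_spec ho t s).1 hi)).2

theorem offeredFraction_nonneg (hs : s.served ≤ 1) : 0 ≤ P.offeredFraction oracle t s :=
  (Finset.le_fold_min _).2 ⟨by linarith, fun i hi => (div_pos
    (Finset.mem_filter.1 (P.topUnit_mem_of_offered ho t s hi)).2
    ((P.offered_spec ho t s).2.1 i hi)).le⟩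

theorem consumed_nonneg (hs : s.served ≤ 1) (i : I) (k : ℕ) :
    0 ≤ P.consumed oracle t s i k := by
  unfold consumed
  split_ifs
  · exact mul_nonneg (P.offeredFraction_nonneg ho t s hs) (P.phi_nonneg _ _ _)
  · exact le_rfl

theorem consumed_le_avail (hz : ∀ i k, 0 ≤ s.avail i k) (i : I) (k : ℕ) :
    P.consumed oracle t s i k ≤ s.avail i k := by
  unfold consumed
  split_ifs with h
  · obtain ⟨hi, rfl⟩ := h
    have h' := ((Finset.le_fold_min _).1 (le_refl (P.offeredFraction oracle t s))).2 i hi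
    exact (le_div_iff₀ ((P.offered_spec ho t s).2.1 i hi)).1 h'
  · exact hz i k

/-- One pass consumes only the top unit of each offered resource, and the reduced price is defined
by exactly that unit. -/
theorem reducedValue_consumed :
    P.reducedValue (P.consumed oracle t s) = P.offeredFraction oracle t s *
      ∑ i ∈ P.offered oracle t s,
        P.reducedPrice s.avail i * P.phi t (P.offered oracle t s) i := by
  unfold reducedValue
  rw [Finset.mul_sum, ← Finset.sum_subset (Finset.subset_univ (P.offered oracle t s))]
  · refine Finset.sum_congr rfl fun i hi => ?_
    have hk := (Finset.mem_filter.1 (P.topUnit_mem_of_offered ho t s hi)).1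
    rw [Finset.sum_eq_single_of_mem _ hk fun k _ hne => by simp [consumed, hne]]
    simp only [consumed, hi, true_and, if_true, reducedPrice]
    ring
  · intro i _ hi
    exact Finset.sum_eq_zero fun k _ => by simp [consumed, hi]

/-- The offer of the loop is worth at least as much as any feasible assortment of neighbors. -/
theorem sum_reducedPrice_le_offered {B : Finset I} (hBn : B ⊆ P.neighbors t)
    (hBf : B ∈ P.feasible) :
    ∑ i ∈ B, P.reducedPrice s.avail i * P.phi t B i ≤
      ∑ i ∈ P.offered oracle t s,
        P.reducedPrice s.avail i * P.phi t (P.offered oracle t s) i := by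
  -- Items out of stock have price zero, so dropping them loses nothing, and by substitutability the
  -- others become no less likely.
  set B' := B.filter fun i => 0 < P.topUnit s.avail i with hB'
  have hsub : B' ⊆ B := Finset.filter_subset _ _
  refine le_trans ?_ ((P.offered_spec ho t s).2.2 B'
    (fun i hi => Finset.mem_filter.2 ⟨hBn (hsub hi), (Finset.mem_filter.1 hi).2⟩)
    (P.feasible_downward B hBf _ hsub))
  rw [← Finset.sum_subset hsub]
  · exact Finset.sum_le_sum fun i hi => mul_le_mul_of_nonneg_left (P.phi_antitone t hsub hi)
      (P.reducedPrice_nonneg _ i)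
  · intro i hi hi'
    rw [P.reducedPrice_eq_zero, zero_mul]
    by_contra h0
    exact hi' (Finset.mem_filter.2 ⟨hi, Nat.pos_of_ne_zero h0⟩)

end Step

/-- Invariant of the while loop of arrival `t` started with availabilities `z`. -/
structure LoopInvariant (P : Instance I) (t : Fin P.T) (z : I → ℕ → ℝ) (s : LoopState I) :
    Prop where
  served_nonneg : 0 ≤ s.served
  served_le : s.served ≤ 1
  avail_nonneg : ∀ i k, 0 ≤ s.avail i k
  used_nonneg : ∀ i k, 0 ≤ s.used i k
  avail_add_used : ∀ i k, s.avail i k + s.used i k = z i k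
  le_reducedValue : ∀ B, B ⊆ P.neighbors t → B ∈ P.feasible →
    s.served * ∑ i ∈ B, P.reducedPrice s.avail i * P.phi t B i ≤ P.reducedValue s.used

/-- Consumption lowers prices, so the bound for the part already served survives at the new prices;
the newly served part is covered by optimality of the offer at the old prices. -/
theorem LoopInvariant.loopStep {P : Instance I}
    {oracle : Fin P.T → Finset I → (I → ℝ) → Finset I} (ho : P.IsRevenueOracle oracle)
    {t : Fin P.T} {z : I → ℕ → ℝ} {s : LoopState I} (h : P.LoopInvariant t z s) :
    P.LoopInvariant t z (P.loopStep oracle t s) := by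
  unfold Instance.loopStep
  split_ifs with hC
  swap
  · exact h
  have hy := P.offeredFraction_nonneg ho t s h.served_le
  have hy1 : P.offeredFraction oracle t s ≤ 1 - s.served :=
    ((Finset.le_fold_min _).1 (le_refl (P.offeredFraction oracle t s))).1
  have hc := P.consumed_nonneg ho t s h.served_le
  refine ⟨add_nonneg h.served_nonneg hy, by simp only; linarith,
    fun i k => sub_nonneg.2 (P.consumed_le_avail ho t s h.avail_nonneg i k),
    fun i k => add_nonneg (h.used_nonneg i k) (hc i k),
    fun i k => by simp only; linarith [h.avail_add_used i k], fun B hBn hBf => ?_⟩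
  have hval : P.reducedValue (fun i k => s.used i k + P.consumed oracle t s i k) =
      P.reducedValue s.used + P.reducedValue (P.consumed oracle t s) := by
    simp only [reducedValue, mul_add, Finset.sum_add_distrib]
  have hprice : ∑ i ∈ B, P.reducedPrice (fun i k => s.avail i k - P.consumed oracle t s i k) i *
      P.phi t B i ≤ ∑ i ∈ B, P.reducedPrice s.avail i * P.phi t B i :=
    Finset.sum_le_sum fun i _ => mul_le_mul_of_nonneg_right
      (P.reducedPrice_mono (fun i k => sub_le_self _ (hc i k)) i) (P.phi_nonneg _ _ _)
  have h1 := mul_le_mul_of_nonneg_left hprice (add_nonneg h.served_nonneg hy)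
  have h2 := mul_le_mul_of_nonneg_left (P.sum_reducedPrice_le_offered ho t s hBn hBf) hy
  have h3 := h.le_reducedValue B hBn hBf
  simp only [hval, P.reducedValue_consumed ho]
  linarith

theorem loopInvariant_loop (P : Instance I) {oracle : Fin P.T → Finset I → (I → ℝ) → Finset I}
    (ho : P.IsRevenueOracle oracle) (t : Fin P.T) {z : I → ℕ → ℝ} (hz : ∀ i k, 0 ≤ z i k) :
    P.LoopInvariant t z (P.loop oracle t z) := by
  unfold loop
  induction ∑ i, P.inventory i with
  | zero => exact ⟨le_rfl, zero_le_one, hz, fun _ _ => le_rfl, by simp, by simp [reducedValue]⟩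
  | succ n ih =>
    rw [Function.iterate_succ_apply']
    exact ih.loopStep ho

theorem reducedValue_nonneg (P : Instance I) {y : I → ℕ → ℝ} (hy : ∀ i k, 0 ≤ y i k) :
    0 ≤ P.reducedValue y :=
  Finset.sum_nonneg fun i _ => Finset.sum_nonneg fun k _ => mul_nonneg
    (mul_nonneg (P.meanReward_nonneg i) (sub_nonneg.2 (Real.exp_le_one_iff.2
      (neg_nonpos.2 (by positivity))))) (hy i k)

/-- The reduced value collected from an arrival is at least the value of any feasible assortment
of neighbors at the prices that hold after the arrival has been served. -/
theorem sum_reducedPrice_le_reducedValue_loop (P : Instance I)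
    {oracle : Fin P.T → Finset I → (I → ℝ) → Finset I} (ho : P.IsRevenueOracle oracle)
    (t : Fin P.T) {z : I → ℕ → ℝ} (hz : ∀ i k, 0 ≤ z i k) {B : Finset I}
    (hBn : B ⊆ P.neighbors t) (hBf : B ∈ P.feasible) :
    ∑ i ∈ B, P.reducedPrice (P.loop oracle t z).avail i * P.phi t B i ≤
      P.reducedValue (P.loop oracle t z).used := by
  have hinv := P.loopInvariant_loop ho t hz
  have hend := P.not_continues_loop ho t z
  by_cases h1 : (P.loop oracle t z).served < 1
  -- The loop has stopped before serving the whole arrival, so no neighbor is in stock and every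
  -- price in `B` is zero.
  · have hempty : ¬ (P.inStock t (P.loop oracle t z).avail).Nonempty := fun h => hend ⟨h1, h⟩
    rw [Finset.sum_eq_zero fun i hi => ?_]
    · exact P.reducedValue_nonneg hinv.used_nonneg
    · rw [P.reducedPrice_eq_zero, zero_mul]
      by_contra h0
      exact hempty ⟨i, Finset.mem_filter.2 ⟨hBn hi, Nat.pos_of_ne_zero h0⟩⟩
  · have := hinv.le_reducedValue B hBn hBf
    rwa [le_antisymm hinv.served_le (not_lt.1 h1), one_mul] at this

/-! ### The fluid process -/

/-- The fraction of an amount of `i` consumed by `τ` that is still in use when `t` is served. -/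
def inUseFraction (P : Instance I) (i : I) (t τ : Fin P.T) : ℝ := 1 - P.returnedFraction i τ t

theorem cdf_mono (P : Instance I) (i : I) {x y : ℝ} (h : x ≤ y) : P.cdf i x ≤ P.cdf i y :=
  ENNReal.toReal_mono (measure_ne_top _ _)
    (measure_mono (Set.Iic_subset_Iic.2 (ENNReal.ofReal_le_ofReal h)))

theorem cdf_nonneg (P : Instance I) (i : I) (x : ℝ) : 0 ≤ P.cdf i x := ENNReal.toReal_nonneg

theorem cdf_le_one (P : Instance I) (i : I) (x : ℝ) : P.cdf i x ≤ 1 :=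
  ENNReal.toReal_mono ENNReal.one_ne_top prob_le_one

theorem returnedFraction_mono (P : Instance I) (i : I) (τ : Fin P.T) {s t : Fin P.T}
    (h : s ≤ t) : P.returnedFraction i τ s ≤ P.returnedFraction i τ t := by
  unfold returnedFraction
  split_ifs with h1 h2 h2
  · exact P.cdf_mono i (sub_le_sub_right (P.arrivalTime_strictMono.monotone h) _)
  · exact absurd (h1.trans_le h) h2
  · exact P.cdf_nonneg _ _
  · exact le_rfl

theorem inUseFraction_nonneg (P : Instance I) (i : I) (t τ : Fin P.T) :
    0 ≤ P.inUseFraction i t τ := by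
  unfold inUseFraction returnedFraction
  split_ifs
  · exact sub_nonneg.2 (P.cdf_le_one _ _)
  · simp

theorem inUseFraction_self (P : Instance I) (i : I) (t : Fin P.T) :
    P.inUseFraction i t t = 1 := by
  simp [inUseFraction, returnedFraction]

/-- By time `t` the later use has run for a shorter time under the same duration law. This is the
kernel monotonicity required by `sum_le_mul_sum_of_exhausted`. -/
theorem inUseFraction_mono (P : Instance I) (i : I) (t τ τ' : Fin P.T) (h : τ ≤ τ')
    (_ : τ' ≤ t) : P.inUseFraction i t τ ≤ P.inUseFraction i t τ' := by
  unfold inUseFraction returnedFraction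
  refine sub_le_sub_left ?_ _
  split_ifs with h1 h2 h2
  · exact P.cdf_mono i (sub_le_sub_left (P.arrivalTime_strictMono.monotone h) _)
  · exact absurd (h.trans_lt h1) h2
  · exact P.cdf_nonneg _ _
  · exact le_rfl

section Guide

variable (P : Instance I) {oracle : Fin P.T → Finset I → (I → ℝ) → Finset I}

/-- `y_i(k, t)` -/
def fluid (oracle : Fin P.T → Finset I → (I → ℝ) → Finset I) (i : I) (k : ℕ) (t : Fin P.T) : ℝ :=
  (P.loop oracle t (P.refreshed t (P.guideState oracle t))).used i k

theorem guideState_succ (oracle : Fin P.T → Finset I → (I → ℝ) → Finset I) (t : Fin P.T) :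
    P.guideState oracle (t + 1) = P.serve oracle t (P.guideState oracle t) := by
  simp [guideState]

/-- The entry of an arrival is written when it is served and never changed afterwards. -/
theorem guideState_matched (oracle : Fin P.T → Finset I → (I → ℝ) → Finset I) (n : ℕ)
    (hn : n ≤ P.T) (i : I) (k : ℕ) (t : Fin P.T) :
    (P.guideState oracle n).matched i k t = if (t : ℕ) < n then P.fluid oracle i k t else 0 := by
  induction n with
  | zero => simp [guideState]
  | succ n ih =>
    rw [P.guideState_succ oracle ⟨n, hn⟩]
    simp only [serve]
    rcases eq_or_ne t ⟨n, hn⟩ with rfl | hne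
    · simp [fluid]
    · rw [Function.update_of_ne hne, ih (by omega)]
      have : (t : ℕ) ≠ n := fun h => hne (Fin.ext h)
      exact if_congr (by omega) rfl rfl

theorem refreshed_eq (oracle : Fin P.T → Finset I → (I → ℝ) → Finset I) (t : Fin P.T) (i : I)
    (k : ℕ) : P.refreshed t (P.guideState oracle t) i k = (P.guideState oracle t).avail i k +
      ∑ τ ∈ Finset.univ.filter (· < t), (P.returnedFraction i τ t -
        P.returnedFraction i τ ⟨t.val - 1, lt_of_le_of_lt (Nat.sub_le _ _) t.isLt⟩) *
          P.fluid oracle i k τ := by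
  unfold refreshed
  congr 1
  refine Finset.sum_congr rfl fun τ hτ => ?_
  rw [P.guideState_matched oracle t t.isLt.le, if_pos]
  exact (Finset.mem_filter.1 hτ).2

/-- Fluid returns are nonnegative only if past consumption is, and the loop preserves signs only
from nonnegative availabilities; hence a joint induction. -/
theorem guideState_nonneg (ho : P.IsRevenueOracle oracle) (n : ℕ) (hn : n ≤ P.T) :
    (∀ i k, 0 ≤ (P.guideState oracle n).avail i k) ∧
      ∀ t : Fin P.T, (t : ℕ) < n → ∀ i k, 0 ≤ P.refreshed t (P.guideState oracle t) i k ∧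
        0 ≤ P.fluid oracle i k t := by
  induction n with
  | zero => simp [guideState]
  | succ n ih =>
    obtain ⟨h1, h2⟩ := ih (by omega)
    have hr : ∀ i k, 0 ≤ P.refreshed ⟨n, hn⟩ (P.guideState oracle n) i k := fun i k => by
      rw [P.refreshed_eq oracle ⟨n, hn⟩]
      refine add_nonneg (h1 i k) (Finset.sum_nonneg fun τ hτ => mul_nonneg (sub_nonneg.2
        (P.returnedFraction_mono i τ ?_)) (h2 τ (Finset.mem_filter.1 hτ).2 i k).2)
      exact Fin.le_def.2 (Nat.sub_le _ _)
    have hinv := P.loopInvariant_loop ho ⟨n, hn⟩ hr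
    refine ⟨fun i k => ?_, fun t ht i k => ?_⟩
    · rw [P.guideState_succ oracle ⟨n, hn⟩]
      exact hinv.avail_nonneg i k
    · rcases Nat.lt_succ_iff_lt_or_eq.1 ht with h | h
      · exact h2 t h i k
      · obtain rfl : t = ⟨n, hn⟩ := Fin.ext h
        exact ⟨hr i k, hinv.used_nonneg i k⟩

theorem refreshed_nonneg (ho : P.IsRevenueOracle oracle) (t : Fin P.T) (i : I) (k : ℕ) :
    0 ≤ P.refreshed t (P.guideState oracle t) i k :=
  ((P.guideState_nonneg ho P.T le_rfl).2 t t.isLt i k).1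

theorem fluid_nonneg (ho : P.IsRevenueOracle oracle) (t : Fin P.T) (i : I) (k : ℕ) :
    0 ≤ P.fluid oracle i k t :=
  ((P.guideState_nonneg ho P.T le_rfl).2 t t.isLt i k).2

/-- Availabilities right after arrival `t` has been served. -/
def availAfter (oracle : Fin P.T → Finset I → (I → ℝ) → Finset I) (t : Fin P.T) : I → ℕ → ℝ :=
  (P.loop oracle t (P.refreshed t (P.guideState oracle t))).avail

theorem guideState_avail_succ (oracle : Fin P.T → Finset I → (I → ℝ) → Finset I) (t : Fin P.T) :
    (P.guideState oracle (t + 1)).avail = P.availAfter oracle t := by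
  rw [P.guideState_succ]; rfl

/-- Conservation of each unit: what returns between consecutive arrivals is exactly the drop of the
part in use, so the returns telescope. -/
theorem availAfter_eq (ho : P.IsRevenueOracle oracle) (t : Fin P.T) (i : I) (k : ℕ) :
    P.availAfter oracle t i k = 1 - ∑ τ ∈ Finset.univ.filter (· ≤ t),
      P.inUseFraction i t τ * P.fluid oracle i k τ := by
  obtain ⟨n, hn⟩ := t
  have hstep : ∀ t : Fin P.T, P.availAfter oracle t i k =
      P.refreshed t (P.guideState oracle t) i k - P.fluid oracle i k t := fun t =>
    eq_sub_of_add_eq ((P.loopInvariant_loop ho t (P.refreshed_nonneg ho t)).avail_add_used i k)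
  have hsplit : ∀ t : Fin P.T, ∑ τ ∈ Finset.univ.filter (· ≤ t),
      P.inUseFraction i t τ * P.fluid oracle i k τ = P.fluid oracle i k t +
        ∑ τ ∈ Finset.univ.filter (· < t), P.inUseFraction i t τ * P.fluid oracle i k τ := by
    intro t
    have : (Finset.univ.filter (· ≤ t)) = insert t (Finset.univ.filter (· < t)) := by
      ext τ; simp [le_iff_eq_or_lt]
    rw [this, Finset.sum_insert (by simp), P.inUseFraction_self, one_mul]
  induction n with
  | zero =>
    -- At arrival `0` the truncated predecessor is harmless, since no earlier arrival contributes.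
    have hemp : (Finset.univ.filter (· < (⟨0, hn⟩ : Fin P.T))) = ∅ := by
      ext τ; simp [Fin.lt_def]
    rw [hstep, P.refreshed_eq, hsplit, hemp]
    simp [guideState]
  | succ n ih =>
    have hset : (Finset.univ.filter (· < (⟨n + 1, hn⟩ : Fin P.T))) =
        Finset.univ.filter (· ≤ (⟨n, by omega⟩ : Fin P.T)) := by
      ext τ; simp [Fin.lt_def, Fin.le_def]
    have hav := P.guideState_avail_succ oracle ⟨n, by omega⟩
    simp only at hav
    rw [hstep, P.refreshed_eq, hsplit, hset]
    simp only [Nat.add_sub_cancel]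
    rw [hav, ih (by omega), ← sub_eq_zero]
    have : ∑ τ ∈ Finset.univ.filter (· ≤ (⟨n, by omega⟩ : Fin P.T)),
        (P.returnedFraction i τ ⟨n + 1, hn⟩ - P.returnedFraction i τ ⟨n, by omega⟩) *
          P.fluid oracle i k τ =
        ∑ τ ∈ Finset.univ.filter (· ≤ (⟨n, by omega⟩ : Fin P.T)),
          P.inUseFraction i ⟨n, by omega⟩ τ * P.fluid oracle i k τ -
        ∑ τ ∈ Finset.univ.filter (· ≤ (⟨n, by omega⟩ : Fin P.T)),
          P.inUseFraction i ⟨n + 1, hn⟩ τ * P.fluid oracle i k τ := by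
      rw [← Finset.sum_sub_distrib]
      exact Finset.sum_congr rfl fun τ _ => by unfold inUseFraction; ring
    rw [this]
    ring

theorem galg_eq (oracle : Fin P.T → Finset I → (I → ℝ) → Finset I) :
    P.galg oracle = ∑ t, ∑ i, ∑ k ∈ Finset.Icc 1 (P.inventory i),
      P.meanReward i * P.fluid oracle i k t := by
  unfold galg
  simp only [P.guideState_matched oracle P.T le_rfl, Fin.is_lt, if_true]

theorem galg_nonneg (ho : P.IsRevenueOracle oracle) : 0 ≤ P.galg oracle := by
  rw [P.galg_eq]
  exact Finset.sum_nonneg fun t _ => Finset.sum_nonneg fun i _ => Finset.sum_nonneg fun k _ =>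
    mul_nonneg (P.meanReward_nonneg i) (P.fluid_nonneg ho t i k)

/-! ### The primal-dual comparison with the fluid relaxation -/

/-- The unit of `i` that prices it after arrival `t` has been served. -/
def topAfter (oracle : Fin P.T → Finset I → (I → ℝ) → Finset I) (t : Fin P.T) (i : I) : ℕ :=
  P.topUnit (P.availAfter oracle t) i

/-- Fluid usage `x` that respects the inventory `c_i` cannot exceed `c_i` times the usage of unit
`k`, when restricted to the arrivals after which unit `k` is exhausted. -/
theorem sum_exhausted_le (ho : P.IsRevenueOracle oracle) (i : I) {x : Fin P.T → ℝ}
    (hx : ∀ t, 0 ≤ x t) (hxc : ∀ t, ∑ τ ∈ Finset.univ.filter (· ≤ t),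
      P.inUseFraction i t τ * x τ ≤ P.inventory i)
    {k : ℕ} (hk : k ∈ Finset.Icc 1 (P.inventory i)) :
    ∑ t, (if P.topAfter oracle t i < k then x t else 0) ≤
      P.inventory i * ∑ t, P.fluid oracle i k t := by
  refine sum_le_mul_sum_of_exhausted (P.inUseFraction i) {t | P.topAfter oracle t i < k} x
    (P.fluid oracle i k) _ (P.inUseFraction_nonneg i) (P.inUseFraction_self i)
    (P.inUseFraction_mono i) (Nat.cast_nonneg _) hx (fun t => P.fluid_nonneg ho t i k) hxc ?_
  intro t ht
  have h1 := P.avail_nonpos_of_topUnit_lt _ hk ht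
  rw [P.availAfter_eq ho] at h1
  linarith

/-- The Riemann bound pays each `x t` out of the units above the top one. After exchanging sums,
unit `k` is charged for the arrivals that find it exhausted, which `sum_exhausted_le` controls. -/
theorem sum_mul_exp_le (ho : P.IsRevenueOracle oracle) (i : I) {x : Fin P.T → ℝ}
    (hx : ∀ t, 0 ≤ x t) (hxc : ∀ t, ∑ τ ∈ Finset.univ.filter (· ≤ t),
      P.inUseFraction i t τ * x τ ≤ P.inventory i) :
    ∑ t, x t * (Real.exp (-((P.topAfter oracle t i : ℝ) / P.inventory i)) - 1 / Real.exp 1 -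
      1 / P.inventory i) ≤ ∑ k ∈ Finset.Icc 1 (P.inventory i),
        Real.exp (-((k : ℝ) / P.inventory i)) * ∑ t, P.fluid oracle i k t := by
  have hc : (0 : ℝ) < P.inventory i := Nat.cast_pos.2 (P.inventory_pos i)
  calc _ ≤ ∑ t, x t * (1 / P.inventory i * ∑ k ∈ (Finset.Icc 1 (P.inventory i)).filter
          (P.topAfter oracle t i < ·), Real.exp (-((k : ℝ) / P.inventory i))) :=
        Finset.sum_le_sum fun t _ => mul_le_mul_of_nonneg_left
          (exp_sub_le_sum_exp (P.inventory_pos i) (P.topUnit_le _ i)) (hx t)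
    _ = ∑ k ∈ Finset.Icc 1 (P.inventory i), Real.exp (-((k : ℝ) / P.inventory i)) *
          (1 / P.inventory i * ∑ t, (if P.topAfter oracle t i < k then x t else 0)) := by
        simp only [Finset.sum_filter, Finset.mul_sum]
        rw [Finset.sum_comm]
        refine Finset.sum_congr rfl fun k _ => Finset.sum_congr rfl fun t _ => ?_
        split_ifs <;> ring
    _ ≤ _ := Finset.sum_le_sum fun k hk => mul_le_mul_of_nonneg_left (by
        rw [one_div, inv_mul_le_iff₀ hc]
        exact P.sum_exhausted_le ho i hx hxc hk) (Real.exp_pos _).le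

/-- The guide algorithm against the fluid relaxation: `p t A` is the probability that `A` is
offered to `t`. -/
theorem sum_meanReward_mul_le_galg (ho : P.IsRevenueOracle oracle)
    (p : Fin P.T → Finset I → ℝ) (hp0 : ∀ t A, 0 ≤ p t A) (hp1 : ∀ t, ∑ A, p t A = 1)
    (hpn : ∀ t A, p t A ≠ 0 → A ⊆ P.neighbors t) (hpf : ∀ t A, p t A ≠ 0 → A ∈ P.feasible)
    (x : Fin P.T → I → ℝ) (hx : ∀ t i, x t i = ∑ A, p t A * P.phi t A i)
    (hxc : ∀ i t, ∑ τ ∈ Finset.univ.filter (· ≤ t), P.inUseFraction i t τ * x τ i ≤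
      P.inventory i) :
    ∑ t, ∑ i, (1 - 1 / Real.exp 1 - 1 / (P.inventory i : ℝ)) * (P.meanReward i * x t i) ≤
      P.galg oracle := by
  have hx0 : ∀ t i, 0 ≤ x t i := fun t i => by
    rw [hx]; exact Finset.sum_nonneg fun A _ => mul_nonneg (hp0 t A) (P.phi_nonneg t A i)
  have hprice : ∀ t, ∑ i, P.reducedPrice (P.availAfter oracle t) i * x t i ≤
      P.reducedValue (fun i k => P.fluid oracle i k t) := by
    intro t
    calc ∑ i, P.reducedPrice (P.availAfter oracle t) i * x t i
        = ∑ A, p t A * ∑ i, P.reducedPrice (P.availAfter oracle t) i * P.phi t A i := by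
          simp only [hx, Finset.mul_sum]
          rw [Finset.sum_comm]
          exact Finset.sum_congr rfl fun A _ => Finset.sum_congr rfl fun i _ => by ring
      _ ≤ ∑ A, p t A * P.reducedValue (fun i k => P.fluid oracle i k t) := by
          refine Finset.sum_le_sum fun A _ => ?_
          by_cases hA : p t A = 0
          · simp [hA]
          refine mul_le_mul_of_nonneg_left ?_ (hp0 t A)
          rw [← Finset.sum_subset (Finset.subset_univ A) fun i _ hi => by
            simp [phi, P.choice_mem t A i hi]]
          exact P.sum_reducedPrice_le_reducedValue_loop ho t (P.refreshed_nonneg ho t)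
            (hpn t A hA) (hpf t A hA)
      _ = _ := by rw [← Finset.sum_mul, hp1, one_mul]
  have hdual : ∀ i, ∑ t, P.meanReward i * (x t i *
      (Real.exp (-((P.topAfter oracle t i : ℝ) / P.inventory i)) - 1 / Real.exp 1 -
        1 / P.inventory i)) ≤ ∑ k ∈ Finset.Icc 1 (P.inventory i),
          P.meanReward i * (Real.exp (-((k : ℝ) / P.inventory i)) *
            ∑ t, P.fluid oracle i k t) := fun i => by
    rw [← Finset.mul_sum, ← Finset.mul_sum]
    exact mul_le_mul_of_nonneg_left
      (P.sum_mul_exp_le ho i (fun t => hx0 t i) (hxc i)) (P.meanReward_nonneg i)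
  -- The terms `exp(-m/c_i)` of the two shares cancel on the left; on the right the weights `1 -
  -- exp(-k/c_i)` and `exp(-k/c_i)` of each unit add up to `1`.
  calc _ = ∑ t, ∑ i, P.reducedPrice (P.availAfter oracle t) i * x t i +
        ∑ i, ∑ t, P.meanReward i * (x t i *
          (Real.exp (-((P.topAfter oracle t i : ℝ) / P.inventory i)) - 1 / Real.exp 1 -
            1 / P.inventory i)) := by
        rw [Finset.sum_comm (γ := I), ← Finset.sum_add_distrib]
        refine Finset.sum_congr rfl fun t _ => ?_
        rw [← Finset.sum_add_distrib]
        refine Finset.sum_congr rfl fun i _ => ?_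
        unfold reducedPrice topAfter
        ring
    _ ≤ ∑ t, P.reducedValue (fun i k => P.fluid oracle i k t) +
        ∑ i, ∑ k ∈ Finset.Icc 1 (P.inventory i), P.meanReward i *
          (Real.exp (-((k : ℝ) / P.inventory i)) * ∑ t, P.fluid oracle i k t) :=
        add_le_add (Finset.sum_le_sum fun t _ => hprice t) (Finset.sum_le_sum fun i _ => hdual i)
    _ = P.galg oracle := by
        rw [P.galg_eq]
        have : ∑ i, ∑ k ∈ Finset.Icc 1 (P.inventory i), P.meanReward i *
            (Real.exp (-((k : ℝ) / P.inventory i)) * ∑ t, P.fluid oracle i k t) =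
            ∑ t, ∑ i, ∑ k ∈ Finset.Icc 1 (P.inventory i), P.meanReward i *
              (Real.exp (-((k : ℝ) / P.inventory i)) * P.fluid oracle i k t) := by
          rw [Finset.sum_comm (γ := Fin P.T)]
          refine Finset.sum_congr rfl fun i _ => ?_
          rw [Finset.sum_comm (γ := Fin P.T)]
          exact Finset.sum_congr rfl fun k _ => by rw [Finset.mul_sum, Finset.mul_sum]
        rw [this, ← Finset.sum_add_distrib]
        refine Finset.sum_congr rfl fun t _ => ?_
        rw [reducedValue, ← Finset.sum_add_distrib]
        refine Finset.sum_congr rfl fun i _ => ?_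
        rw [← Finset.sum_add_distrib]
        exact Finset.sum_congr rfl fun k _ => by ring

end Guide

/-! ### The fluid relaxation of a clairvoyant policy -/

section Clairvoyant

variable {P : Instance I} (π : P.Policy)

/-- The offer to `t` depends only on the coordinates of the sample path before `t`. -/
theorem Policy.offer_congr (t : Fin P.T) {ω ω' : P.Path}
    (h : ∀ τ, τ < t → ω.1 τ = ω'.1 τ ∧ ω.2 τ = ω'.2 τ) : π.offer t ω = π.offer t ω' := by
  induction t using WellFoundedLT.induction with
  | ind t ih =>
    refine π.nonanticipating t ω ω' fun τ hτ => ⟨?_, fun i _ => ⟨?_, fun _ => ?_⟩⟩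
    · unfold chosen
      rw [ih τ hτ fun σ hσ => h σ (hσ.trans hτ), (h τ hτ).2]
    · unfold Returned
      rw [(h τ hτ).1]
    · rw [(h τ hτ).1]

/-- Probability that a policy makes arrival `t` choose `i`. -/
def Policy.chosenProb (t : Fin P.T) (i : I) : ℝ≥0∞ :=
  ∑ A, P.pathLaw {ω | π.offer t ω = A} * P.choice t A (some i)

theorem measurableSet_outcome (P : Instance I) (t : Fin P.T) (A : Finset I) (i : I) :
    MeasurableSet {v : Fin P.T → Finset I → Option I | v t A = some i} := by
  have h : Measurable fun v : Fin P.T → Finset I → Option I => v t A :=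
    (measurable_pi_apply A).comp (measurable_pi_apply t)
  exact h (show MeasurableSet {o : Option I | o = some i} from trivial)

theorem measurable_duration (P : Instance I) (t : Fin P.T) (i : I) :
    Measurable fun u : Fin P.T → I → ℝ≥0∞ => u t i :=
  (measurable_pi_apply i).comp (measurable_pi_apply t)

theorem Policy.measurableSet_chosen (t : Fin P.T) (i : I) :
    MeasurableSet {ω | P.chosen π.offer t ω = some i} := by
  have : {ω | P.chosen π.offer t ω = some i} =
      ⋃ A, {ω | π.offer t ω = A} ∩ {ω | ω.2 t A = some i} := by
    ext ω; simp [chosen]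
  rw [this]
  exact MeasurableSet.iUnion fun A => (π.measurable_offer t A).inter
    (measurable_snd (P.measurableSet_outcome t A i))

open Classical in
/-- Offer, choice and duration of the same arrival are independent. -/
theorem Policy.lintegral_offer_mul (t : Fin P.T) (A : Finset I) (i : I) {h : ℝ≥0∞ → ℝ≥0∞}
    (hh : Measurable h) :
    ∫⁻ ω, (if π.offer t ω = A then 1 else 0) *
        (if ω.2 t A = some i then 1 else 0) * h (ω.1 t i) ∂P.pathLaw =
      P.pathLaw {ω | π.offer t ω = A} * P.choice t A (some i) *
        ∫⁻ d, h d ∂(P.usage i : Measure ℝ≥0∞) := by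
  set μ : Measure (Fin P.T → I → ℝ≥0∞) := Measure.pi fun _ : Fin P.T =>
    Measure.pi fun i : I => (P.usage i : Measure ℝ≥0∞) with hμ
  set ν : Measure (Fin P.T → Finset I → Option I) := Measure.pi fun t : Fin P.T =>
    Measure.pi fun A : Finset I => (P.choice t A).toMeasure with hν
  have hlaw : P.pathLaw = μ.prod ν := rfl
  let F : P.Path → ℝ≥0∞ := fun ω => if π.offer t ω = A then 1 else 0
  have hF : Measurable F := Measurable.ite (π.measurable_offer t A) measurable_const
    measurable_const
  -- The offer to `t` ignores coordinate `t` of both components, so the choice splits off in the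
  -- inner integral and the duration in the outer one.
  have hF1 : ∀ u v y, F (Function.update u t y, v) = F (u, v) := fun u v y => by
    simp only [F]
    rw [π.offer_congr t (ω := (Function.update u t y, v)) (ω' := (u, v))
      fun τ hτ => ⟨Function.update_of_ne hτ.ne _ _, rfl⟩]
  have hF2 : ∀ u v y, F (u, Function.update v t y) = F (u, v) := fun u v y => by
    simp only [F]
    rw [π.offer_congr t (ω := (u, Function.update v t y)) (ω' := (u, v))
      fun τ hτ => ⟨rfl, Function.update_of_ne hτ.ne _ _⟩]
  have hset : MeasurableSet {w : Finset I → Option I | w A = some i} :=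
    (measurable_pi_apply A : Measurable fun w : Finset I → Option I => w A)
      (show MeasurableSet {o : Option I | o = some i} from trivial)
  have hb : Measurable fun w : Finset I → Option I => if w A = some i then (1 : ℝ≥0∞) else 0 :=
    Measurable.ite hset measurable_const measurable_const
  have hbν : ∫⁻ w, (if w A = some i then (1 : ℝ≥0∞) else 0)
      ∂(Measure.pi fun A : Finset I => (P.choice t A).toMeasure) = P.choice t A (some i) := by
    have h1 := (measurePreserving_eval
      (fun A : Finset I => (P.choice t A).toMeasure) A).measure_preimage
      (s := {some i})
      (show MeasurableSet ({some i} : Set (Option I)) from trivial).nullMeasurableSet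
    rw [PMF.toMeasure_apply_singleton _ _
      (show MeasurableSet ({some i} : Set (Option I)) from trivial)] at h1
    refine Eq.trans ?_ h1
    change _ = (Measure.pi fun A : Finset I => (P.choice t A).toMeasure) {w | w A = some i}
    rw [← lintegral_indicator_one hset]
    exact lintegral_congr fun w => by by_cases hc : w A = some i <;> simp [hc]
  have hhμ : ∫⁻ w : I → ℝ≥0∞, h (w i) ∂(Measure.pi fun i : I => (P.usage i : Measure ℝ≥0∞)) =
      ∫⁻ d, h d ∂(P.usage i : Measure ℝ≥0∞) :=
    (measurePreserving_eval (fun i : I => (P.usage i : Measure ℝ≥0∞)) i).lintegral_comp hh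
  have hinner : ∀ u, ∫⁻ v, F (u, v) * (if v t A = some i then 1 else 0) * h (u t i) ∂ν =
      (∫⁻ v, F (u, v) ∂ν) * P.choice t A (some i) * h (u t i) := fun u => by
    have hFu : Measurable fun v => F (u, v) := hF.comp measurable_prodMk_left
    have hm : Measurable fun v : Fin P.T → Finset I → Option I =>
        F (u, v) * (if v t A = some i then 1 else 0) :=
      hFu.mul (hb.comp (measurable_pi_apply t))
    have hev : ∫⁻ v, F (u, v) * (if v t A = some i then 1 else 0) ∂ν =
        (∫⁻ v, F (u, v) ∂ν) * P.choice t A (some i) :=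
      (lintegral_mul_eval _ t hFu hb (hF2 u)).trans (by rw [hbν])
    rw [lintegral_mul_const _ hm, hev]
  have hmeas : Measurable fun ω : P.Path =>
      F ω * (if ω.2 t A = some i then 1 else 0) * h (ω.1 t i) :=
    (hF.mul (hb.comp ((measurable_pi_apply t).comp measurable_snd))).mul
      (hh.comp ((P.measurable_duration t i).comp measurable_fst))
  have hFint : ∫⁻ ω, F ω ∂P.pathLaw = P.pathLaw {ω | π.offer t ω = A} := by
    rw [← lintegral_indicator_one (π.measurable_offer t A)]
    exact lintegral_congr fun ω => by by_cases hc : π.offer t ω = A <;> simp [F, hc]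
  change ∫⁻ ω, F ω * (if ω.2 t A = some i then 1 else 0) * h (ω.1 t i) ∂P.pathLaw = _
  rw [← hFint, hlaw, lintegral_prod _ hmeas.aemeasurable, lintegral_prod _ hF.aemeasurable]
  simp only [hinner]
  have hf : Measurable fun u => ∫⁻ v, F (u, v) ∂ν := hF.lintegral_prod_right'
  rw [← hhμ, ← lintegral_mul_const _ hf]
  exact lintegral_mul_eval (fun _ : Fin P.T => Measure.pi fun i : I => (P.usage i : Measure ℝ≥0∞))
    t (hf.mul_const _) (hh.comp (measurable_pi_apply i)) fun u y => by simp only [hF1]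

open Classical in
-- Summing `lintegral_offer_mul` over the possible offers, of which exactly one is made on each
-- path.
theorem Policy.lintegral_chosen (t : Fin P.T) (i : I) {h : ℝ≥0∞ → ℝ≥0∞} (hh : Measurable h) :
    ∫⁻ ω, (if P.chosen π.offer t ω = some i then h (ω.1 t i) else 0) ∂P.pathLaw =
      π.chosenProb t i * ∫⁻ d, h d ∂(P.usage i : Measure ℝ≥0∞) := by
  have hpt : ∀ ω : P.Path, (if P.chosen π.offer t ω = some i then h (ω.1 t i) else 0) =
      ∑ A, (if π.offer t ω = A then 1 else 0) *
        (if ω.2 t A = some i then 1 else 0) * h (ω.1 t i) := fun ω => by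
    rw [Finset.sum_eq_single_of_mem (π.offer t ω) (Finset.mem_univ _) fun A _ hA => by
      simp [hA.symm]]
    by_cases hc : ω.2 t (π.offer t ω) = some i <;> simp [chosen, hc]
  simp only [hpt]
  rw [lintegral_finsetSum, chosenProb, Finset.sum_mul]
  · exact Finset.sum_congr rfl fun A _ => π.lintegral_offer_mul t A i hh
  · intro A _
    exact ((Measurable.ite (π.measurable_offer t A) measurable_const measurable_const).mul
      (Measurable.ite (measurable_snd (P.measurableSet_outcome t A i)) measurable_const
        measurable_const)).mul (hh.comp ((P.measurable_duration t i).comp measurable_fst))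

theorem Policy.chosenProb_ne_top (t : Fin P.T) (i : I) : π.chosenProb t i ≠ ∞ :=
  ENNReal.sum_ne_top.2 fun _ _ => ENNReal.mul_ne_top (measure_ne_top _ _) (PMF.apply_ne_top _ _)

/-- Almost surely only offered items are chosen. -/
theorem Policy.ae_mem_offer :
    ∀ᵐ ω ∂P.pathLaw, ∀ t i, P.chosen π.offer t ω = some i → i ∈ π.offer t ω := by
  classical
  rw [ae_all_iff]; intro t
  rw [ae_all_iff]; intro i
  have hA : ∀ A : Finset I, i ∉ A → ∀ᵐ ω ∂P.pathLaw, ¬ (π.offer t ω = A ∧ ω.2 t A = some i) := by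
    intro A hi
    have h := π.lintegral_offer_mul t A i (h := fun _ => 1) measurable_const
    rw [P.choice_mem t A i hi, mul_zero, zero_mul, lintegral_eq_zero_iff] at h
    · filter_upwards [h] with ω hω hc
      simp [hc.1, hc.2] at hω
    · exact ((Measurable.ite (π.measurable_offer t A) measurable_const measurable_const).mul
        (Measurable.ite (measurable_snd (P.measurableSet_outcome t A i)) measurable_const
          measurable_const)).mul measurable_const
  have hall : ∀ᵐ ω ∂P.pathLaw, ∀ A : Finset I, i ∉ A → ¬ (π.offer t ω = A ∧ ω.2 t A = some i) := by
    rw [ae_all_iff]; intro A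
    by_cases hi : i ∈ A
    · exact .of_forall fun ω h => absurd hi h
    · filter_upwards [hA A hi] with ω hω _ using hω
  filter_upwards [hall] with ω hω hc
  by_contra hi
  exact hω _ hi ⟨rfl, hc⟩

open Classical in
/-- Together with the unit that `t` takes, never more than `c_i` units of `i` are in use. -/
theorem Policy.card_inUse_le {ω : P.Path}
    (hω : ∀ t i, P.chosen π.offer t ω = some i → i ∈ π.offer t ω) (i : I) (t : Fin P.T) :
    (Finset.univ.filter fun τ : Fin P.T => τ ≤ t ∧ P.chosen π.offer τ ω = some i ∧
      (τ < t → ¬ P.Returned i τ t ω)).card ≤ P.inventory i := by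
  set K := Finset.univ.filter fun τ : Fin P.T => τ ≤ t ∧ P.chosen π.offer τ ω = some i ∧
      (τ < t → ¬ P.Returned i τ t ω) with hK
  rcases K.eq_empty_or_nonempty with h0 | hne
  · simp [h0]
  -- The last counted arrival `σ` took a unit in stock, and every other counted use was already
  -- running then, being still out at the later time `t`.
  set σ := K.max' hne with hσ
  have hσK : σ ∈ K := K.max'_mem hne
  obtain ⟨-, hσt, hσc, -⟩ := Finset.mem_filter.1 hσK
  have hlt := π.offer_available σ ω i (hω σ i hσc)
  have hsub : K ⊆ insert σ (Finset.univ.filter fun τ : Fin P.T =>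
      τ < σ ∧ P.chosen π.offer τ ω = some i ∧ ¬ P.Returned i τ σ ω) := by
    intro τ hτ
    rcases (K.le_max' τ hτ).eq_or_lt with h | h
    · exact Finset.mem_insert.2 (Or.inl h)
    · obtain ⟨-, -, hc, hr⟩ := Finset.mem_filter.1 hτ
      refine Finset.mem_insert_of_mem (Finset.mem_filter.2 ⟨Finset.mem_univ _, h, hc, fun hret =>
        hr (h.trans_le hσt) (hret.trans (ENNReal.ofReal_le_ofReal ?_))⟩)
      exact sub_le_sub_right (P.arrivalTime_strictMono.monotone hσt) _
  refine (Finset.card_le_card hsub).trans ((Finset.card_insert_le _ _).trans ?_)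
  exact hlt

/-- The premise `τ < t` keeps `t`'s own use counted even if its duration is zero, in line with
`returnedFraction`. -/
theorem lintegral_not_returned (P : Instance I) (i : I) (t τ : Fin P.T) :
    ∫⁻ d, {d | τ < t → ¬ d ≤ ENNReal.ofReal (P.arrivalTime t - P.arrivalTime τ)}.indicator 1 d
      ∂(P.usage i : Measure ℝ≥0∞) = ENNReal.ofReal (P.inUseFraction i t τ) := by
  by_cases h : τ < t
  · have hset : {d | τ < t → ¬ d ≤ ENNReal.ofReal (P.arrivalTime t - P.arrivalTime τ)} =
        (Set.Iic (ENNReal.ofReal (P.arrivalTime t - P.arrivalTime τ)))ᶜ := by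
      ext d; simp [h]
    rw [hset, lintegral_indicator_one measurableSet_Iic.compl, prob_compl_eq_one_sub
      measurableSet_Iic, inUseFraction, returnedFraction, if_pos h, cdf,
      ENNReal.ofReal_sub _ ENNReal.toReal_nonneg, ENNReal.ofReal_one,
      ENNReal.ofReal_toReal (measure_ne_top _ _)]
  · simp [h, inUseFraction, returnedFraction]

/-- The fluid inventory constraint. -/
theorem Policy.sum_inUseFraction_mul_le (i : I) (t : Fin P.T) :
    ∑ τ ∈ Finset.univ.filter (· ≤ t), P.inUseFraction i t τ * (π.chosenProb τ i).toReal ≤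
      P.inventory i := by
  classical
  let h : Fin P.T → ℝ≥0∞ → ℝ≥0∞ := fun τ =>
    {d | τ < t → ¬ d ≤ ENNReal.ofReal (P.arrivalTime t - P.arrivalTime τ)}.indicator 1
  have hh : ∀ τ, Measurable (h τ) := fun τ => by
    refine measurable_one.indicator ?_
    by_cases hτ : τ < t
    · simp only [hτ, true_implies, not_le]
      exact measurableSet_Ioi
    · simp [hτ]
  have hterm : ∀ τ, ENNReal.ofReal (P.inUseFraction i t τ * (π.chosenProb τ i).toReal) =
      ∫⁻ ω, (if P.chosen π.offer τ ω = some i then h τ (ω.1 τ i) else 0) ∂P.pathLaw := fun τ => by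
    rw [π.lintegral_chosen τ i (hh τ), P.lintegral_not_returned,
      ENNReal.ofReal_mul (P.inUseFraction_nonneg i t τ),
      ENNReal.ofReal_toReal (π.chosenProb_ne_top τ i), mul_comm]
  -- The inventory constraint holds on almost every path; taking expectations turns it into the
  -- fluid constraint.
  have hle : ∀ᵐ ω ∂P.pathLaw, ∑ τ ∈ Finset.univ.filter (· ≤ t),
      (if P.chosen π.offer τ ω = some i then h τ (ω.1 τ i) else 0) ≤ P.inventory i := by
    filter_upwards [π.ae_mem_offer] with ω hω
    have hcard := π.card_inUse_le hω i t
    calc _ = ∑ τ, if (τ ≤ t ∧ P.chosen π.offer τ ω = some i ∧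
            (τ < t → ¬ P.Returned i τ t ω)) then (1 : ℝ≥0∞) else 0 := by
          rw [Finset.sum_filter]
          refine Finset.sum_congr rfl fun τ _ => ?_
          by_cases h1 : τ ≤ t <;> by_cases h2 : P.chosen π.offer τ ω = some i <;>
            simp [h1, h2, h, Set.indicator_apply, Returned]
      _ ≤ _ := by
          rw [Finset.sum_boole]
          exact_mod_cast hcard
  rw [← ENNReal.ofReal_le_ofReal_iff (Nat.cast_nonneg _), ENNReal.ofReal_natCast,
    ENNReal.ofReal_sum_of_nonneg fun τ _ =>
      mul_nonneg (P.inUseFraction_nonneg i t τ) ENNReal.toReal_nonneg]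
  simp only [hterm]
  rw [← lintegral_finsetSum]
  · refine (lintegral_mono_ae hle).trans_eq ?_
    rw [lintegral_const, measure_univ, mul_one]
  · intro τ _
    exact Measurable.ite (π.measurableSet_chosen τ i)
      ((hh τ).comp ((P.measurable_duration τ i).comp measurable_fst)) measurable_const

/-- Durations are drawn after the choice, so every use of `i` earns `r_i` on average. -/
theorem Policy.value_eq :
    π.value = ∑ t, ∑ i, P.meanReward i * (π.chosenProb t i).toReal := by
  classical
  let g : Fin P.T → I → P.Path → ℝ := fun t i ω =>
    if P.chosen π.offer t ω = some i then P.reward i (ω.1 t i) else 0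
  have htotal : ∀ ω, π.total ω = ∑ t, ∑ i, g t i ω := fun ω => by
    refine Finset.sum_congr rfl fun t _ => ?_
    simp only [g]
    cases P.chosen π.offer t ω with
    | none => simp
    | some i => simp
  have hg0 : ∀ t i ω, 0 ≤ g t i ω := fun t i ω => by
    simp only [g]
    split_ifs
    exacts [P.reward_nonneg _ _, le_rfl]
  have hgm : ∀ t i, Measurable (g t i) := fun t i =>
    Measurable.ite (π.measurableSet_chosen t i) ((P.reward_mono i).measurable.comp
      ((P.measurable_duration t i).comp measurable_fst)) measurable_const
  have hlint : ∀ t i, ∫⁻ ω, ENNReal.ofReal (g t i ω) ∂P.pathLaw =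
      π.chosenProb t i * ENNReal.ofReal (P.meanReward i) := fun t i => by
    rw [meanReward, ofReal_integral_eq_lintegral_ofReal (P.reward_integrable i)
      (.of_forall (P.reward_nonneg i)),
      ← π.lintegral_chosen t i (P.reward_mono i).measurable.ennreal_ofReal]
    refine lintegral_congr fun ω => ?_
    simp only [g]
    split_ifs <;> simp
  have hgi : ∀ t i, Integrable (g t i) P.pathLaw := fun t i => by
    rw [← lintegral_ofReal_ne_top_iff_integrable (hgm t i).aestronglyMeasurable
      (.of_forall (hg0 t i)), hlint]
    exact ENNReal.mul_ne_top (π.chosenProb_ne_top t i) ENNReal.ofReal_ne_top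
  unfold Policy.value
  simp only [htotal]
  rw [integral_finsetSum _ fun t _ => integrable_finsetSum _ fun i _ => hgi t i]
  refine Finset.sum_congr rfl fun t _ => ?_
  rw [integral_finsetSum _ fun i _ => hgi t i]
  refine Finset.sum_congr rfl fun i _ => ?_
  rw [integral_eq_lintegral_of_nonneg_ae (.of_forall (hg0 t i)) (hgm t i).aestronglyMeasurable,
    hlint, ENNReal.toReal_mul, ENNReal.toReal_ofReal (P.meanReward_nonneg i), mul_comm]

theorem Policy.sum_offer_eq_one (t : Fin P.T) :
    ∑ A, (P.pathLaw {ω | π.offer t ω = A}).toReal = 1 := by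
  rw [← ENNReal.toReal_sum fun A _ => measure_ne_top _ _, ← measure_biUnion_finset
    (fun A _ B _ hAB => Set.disjoint_left.2 fun ω hA hB => hAB (hA.symm.trans hB))
    fun A _ => π.measurable_offer t A]
  have : ⋃ A ∈ (Finset.univ : Finset (Finset I)), {ω | π.offer t ω = A} = Set.univ := by
    ext ω; simp
  rw [this, measure_univ, ENNReal.toReal_one]

theorem Policy.exists_offer {t : Fin P.T} {A : Finset I}
    (h : (P.pathLaw {ω | π.offer t ω = A}).toReal ≠ 0) : ∃ ω, π.offer t ω = A := by
  by_contra! hne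
  exact h (by simp [hne])

/-! ### From the fluid bound to the clairvoyant optimum -/

theorem cMin_le (P : Instance I) (i : I) : P.cMin ≤ P.inventory i :=
  ciInf_le (OrderBot.bddBelow _) i

theorem cMin_pos (P : Instance I) (i : I) : 0 < P.cMin := by
  have : Nonempty I := ⟨i⟩
  exact Nat.succ_le_iff.1 (le_ciInf fun j => Nat.succ_le_iff.2 (P.inventory_pos j))

theorem Policy.mul_value_le_galg {oracle : Fin P.T → Finset I → (I → ℝ) → Finset I}
    (ho : P.IsRevenueOracle oracle) :
    (1 - 1 / Real.exp 1 - 1 / (P.cMin : ℝ)) * π.value ≤ P.galg oracle := by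
  refine le_trans ?_ (P.sum_meanReward_mul_le_galg ho
    (fun t A => (P.pathLaw {ω | π.offer t ω = A}).toReal) (fun _ _ => ENNReal.toReal_nonneg)
    π.sum_offer_eq_one
    (fun t A h => by
      obtain ⟨ω, rfl⟩ := π.exists_offer h
      exact π.offer_neighbors t ω)
    (fun t A h => by
      obtain ⟨ω, rfl⟩ := π.exists_offer h
      exact π.offer_feasible t ω)
    (fun t i => (π.chosenProb t i).toReal)
    (fun t i => by
      rw [chosenProb, ENNReal.toReal_sum fun A _ =>
        ENNReal.mul_ne_top (measure_ne_top _ _) (PMF.apply_ne_top _ _)]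
      exact Finset.sum_congr rfl fun A _ => ENNReal.toReal_mul)
    π.sum_inUseFraction_mul_le)
  rw [π.value_eq, Finset.mul_sum]
  refine Finset.sum_le_sum fun t _ => ?_
  rw [Finset.mul_sum]
  refine Finset.sum_le_sum fun i _ => mul_le_mul_of_nonneg_right ?_
    (mul_nonneg (P.meanReward_nonneg i) ENNReal.toReal_nonneg)
  -- A resource `i` is at hand here, so `cMin` is positive; without resources the sums are empty and
  -- the value of `cMin` is irrelevant.
  exact sub_le_sub_left (one_div_le_one_div_of_le (Nat.cast_pos.2 (P.cMin_pos i))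
    (Nat.cast_le.2 (P.cMin_le i))) _

end Clairvoyant

theorem opt_nonneg (P : Instance I) : 0 ≤ P.opt := by
  refine Real.iSup_nonneg fun π => ?_
  rw [π.value_eq]
  exact Finset.sum_nonneg fun t _ => Finset.sum_nonneg fun i _ =>
    mul_nonneg (P.meanReward_nonneg i) ENNReal.toReal_nonneg

end Instance

end ReusableAssortment

end

theorem mainTheorem7 :
    ∃ C : ℝ, ∀ (I : Type u) [Fintype I] [DecidableEq I] (P : ReusableAssortment.Instance I)
      (oracle : Fin P.T → Finset I → (I → ℝ) → Finset I), P.IsRevenueOracle oracle →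
      (1 - 1 / Real.exp 1 - C / (P.cMin : ℝ)) * P.opt ≤ P.galg oracle := by
  refine ⟨1, fun I _ _ P oracle ho => ?_⟩
  -- Only a positive factor can be moved across to pass to the supremum over policies; otherwise the
  -- left side is nonpositive.
  rcases le_or_gt (1 - 1 / Real.exp 1 - 1 / (P.cMin : ℝ)) 0 with h | h
  · exact (mul_nonpos_of_nonpos_of_nonneg h P.opt_nonneg).trans (P.galg_nonneg ho)
  · rw [mul_comm, ← le_div_iff₀ h]
    refine ciSup_le fun π => ?_
    rw [le_div_iff₀ h, mul_comm]
    exact π.mul_value_le_galg ho
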